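/- Let $d\ge 2$, $S^1=\mathbb R/2\pi\mathbb Z$, and let $W^{1,\infty}$ be the Banach space of Lipschitz functions $c\colon S^1\to\mathbb R^d$ with norm $\|c\|_{L^\infty}+\|c_\theta\|_{L^\infty}$. Put $W^{1,\infty}_0=\{c\in W^{1,\infty}:\int_{S^1}c\,d\theta=0\}$ and let $\mathcal I^{1,\infty}_0=\{c\in W^{1,\infty}_0:\operatorname{ess\,inf}_\theta|c_\theta|>0\}$, an open subset of $W^{1,\infty}_0$ representing the Lipschitz immersions modulo translations, with tangent bundle $\mathcal I^{1,\infty}_0\times W^{1,\infty}_0$. For $c\in\mathcal I^{1,\infty}_0$ write $ds=|c_\theta|\,d\theta$, $\ell_c=\int_{S^1}ds$, $D_sh=|c_\theta|^{-1}h_\theta$, $$G_c(h,k)=\frac1{\ell_c}\int_{S^1}\langle D_sh,D_sk\rangle\,ds ,$$ let $\pi_0f=f-\frac1{\ell_c}\int_{S^1}f\,ds$, and let $D_s^{-1}$ be the inverse of $D_s\colon W^{1,\infty}_0\to\{f\in L^\infty(S^1,\mathbb R^d):\int_{S^1} f\,ds=0\}$. The geodesic equation of the weak Riemannian metric $G$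 is $$c_{tt}=G_c(c,c_t)\,c_t-\tfrac12G_c(c_t,c_t)\,c+D_s^{-1}\pi_0\Big(\langle D_sc,D_sc_t\rangle D_sc_t-\tfrac12|D_sc_t|^2D_sc\Big)\qquad(1)$$ for paths $t\mapsto c(t)\in\mathcal I^{1,\infty}_0$, with time derivatives taken in $W^{1,\infty}_0$. **Theorem.** 1. For every $c_0\in\mathcal I^{1,\infty}_0$ and $h_0\in W^{1,\infty}_0$ there are $\varepsilon>0$ and a solution $c\colon(-\varepsilon,\varepsilon)\to\mathcal I^{1,\infty}_0$ of (1) with $c(0)=c_0$, $c_t(0)=h_0$. Any two solutions on an interval containing $0$ that have the same initial position and velocity coincide on that interval. 2. The solutions depend smoothly on $t$ and on the initial data: let $\mathcal D\subseteq\mathbb R\times W^{1,\infty}_0\times W^{1,\infty}_0$ be the set of all $(t,c_0,h_0)$, $c_0\in\mathcal I^{1,\infty}_0$, such that the solution with initial data $(c_0,h_0)$ exists on an open interval containing $0$ and $t$. Then $\mathcal D$ is open, and the map sending $(t,c_0,h_0)\in\mathcal D$ to the value at time $t$ of that solution is $C^\infty$ on $\mathcal D$. 3. Let $\exp_c h$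 be the value at time $1$ of the solution with initial data $(c,h)$, whenever $(1,c,h)\in\mathcal D$. There is an open neighbourhood $U$ of the zero section $\mathcal I^{1,\infty}_0\times\{0\}$ on which $\exp$ is defined and $C^\infty$, and an open neighbourhood $V\subseteq U$ of the zero section such that $(c,h)\mapsto(c,\exp_ch)$ is a $C^\infty$ local diffeomorphism on $V$ whose image $W$ is an open subset of $\mathcal I^{1,\infty}_0\times\mathcal I^{1,\infty}_0$ containing the diagonal $\{(c,c):c\in\mathcal I^{1,\infty}_0\}$. -/

import Mathlib

open MeasureTheory Set Topology
open scoped ContDiff Manifold NNReal ENNReal RealInnerProductSpace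

namespace LipschitzCurve

instance fact_two_pi_pos : Fact ((0 : ℝ) < 2 * Real.pi) := ⟨Real.two_pi_pos⟩

/-- The circle `S¹ = ℝ/(2πℤ)`; its `volume` has total mass `2π`, i.e. it is `dθ`. -/
abbrev S1 : Type := AddCircle (2 * Real.pi)

/-- Euclidean space `ℝ^d`. -/
abbrev Euc (d : ℕ) : Type := EuclideanSpace ℝ (Fin d)

/-- The linear space of Lipschitz continuous functions `S¹ → ℝ^d`. -/
def lipSubmodule (d : ℕ) : Submodule ℝ (S1 → Euc d) where
  carrier := {c | ∃ K : ℝ≥0, LipschitzWith K c}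
  add_mem' := by
    rintro a b ⟨K, hK⟩ ⟨L, hL⟩
    exact ⟨K + L, hK.add hL⟩
  zero_mem' := ⟨0, LipschitzWith.const 0⟩
  smul_mem' := by
    rintro r a ⟨K, hK⟩
    exact ⟨‖r‖₊ * K, (lipschitzWith_smul r).comp hK⟩

/-- `W^{1,∞}`: the Lipschitz continuous functions `S¹ → ℝ^d`. This is a type synonym, so that it does
not carry the topology of pointwise convergence; its norm is defined below. -/
def W1 (d : ℕ) : Type := lipSubmodule d

noncomputable instance (d : ℕ) : AddCommGroup (W1 d) := inferInstanceAs (AddCommGroup (lipSubmodule d))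

noncomputable instance (d : ℕ) : Module ℝ (W1 d) := inferInstanceAs (Module ℝ (lipSubmodule d))

instance (d : ℕ) : FunLike (W1 d) S1 (Euc d) where
  coe c := c.1
  coe_injective := Subtype.val_injective

theorem W1.exists_lipschitz {d : ℕ} (c : W1 d) : ∃ K : ℝ≥0, LipschitzWith K (c : S1 → Euc d) := c.2

theorem W1.add_apply {d : ℕ} (c h : W1 d) (θ : S1) : (c + h) θ = c θ + h θ := rfl

theorem W1.smul_apply {d : ℕ} (r : ℝ) (c : W1 d) (θ : S1) : (r • c) θ = r • c θ := rfl

/-- The derivative `c_θ` of a function on the circle. -/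
noncomputable def dTheta {d : ℕ} (c : S1 → Euc d) (θ : S1) : Euc d :=
  deriv (fun x : ℝ => c (θ + (x : S1))) 0

/-- The representative in `[0, 2π)` of a point of the circle. -/
noncomputable def rep (θ : S1) : ℝ := (AddCircle.equivIco (2 * Real.pi) 0 θ : ℝ)

theorem coe_rep (θ : S1) : ((rep θ : ℝ) : S1) = θ := AddCircle.coe_equivIco

theorem measurable_rep : Measurable rep :=
  measurable_subtype_coe.comp (AddCircle.measurableEquivIco (2 * Real.pi) 0).measurable

theorem dTheta_coe {d : ℕ} (c : S1 → Euc d) (y : ℝ) :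
    dTheta c (y : S1) = deriv (fun x : ℝ => c (x : S1)) y := by
  have h := deriv_comp_const_add (f := fun x : ℝ => c (x : S1)) y 0
  simpa [dTheta, AddCircle.coe_add] using h

theorem dTheta_eq_rep {d : ℕ} (c : S1 → Euc d) (θ : S1) :
    dTheta c θ = deriv (fun x : ℝ => c (x : S1)) (rep θ) := by
  rw [← dTheta_coe, coe_rep]

theorem measurable_dTheta {d : ℕ} (c : S1 → Euc d) : Measurable (dTheta c) := by
  have : dTheta c = (deriv fun x : ℝ => c (x : S1)) ∘ rep := funext (dTheta_eq_rep c)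
  rw [this]
  exact (measurable_deriv _).comp measurable_rep

theorem lipschitz_lift {d : ℕ} {c : S1 → Euc d} {K : ℝ≥0} (hc : LipschitzWith K c) :
    LipschitzWith K (fun x : ℝ => c (x : S1)) := by
  refine LipschitzWith.of_dist_le_mul fun x y => (hc.dist_le_mul _ _).trans ?_
  gcongr
  rw [dist_eq_norm, dist_eq_norm, ← AddCircle.coe_sub]
  exact QuotientAddGroup.norm_mk_le_norm

theorem norm_dTheta_le {d : ℕ} {c : S1 → Euc d} {K : ℝ≥0} (hc : LipschitzWith K c) (θ : S1) :
    ‖dTheta c θ‖ ≤ K := by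
  rw [dTheta_eq_rep]
  exact norm_deriv_le_of_lipschitz (lipschitz_lift hc)

theorem differentiableAt_iff {d : ℕ} (c : S1 → Euc d) (y : ℝ) :
    DifferentiableAt ℝ (fun x : ℝ => c ((y : S1) + (x : S1))) 0 ↔
      DifferentiableAt ℝ (fun x : ℝ => c (x : S1)) y := by
  have h := differentiableAt_comp_add_left (𝕜 := ℝ) (f := fun x : ℝ => c (x : S1)) (x := 0) y
  simpa [AddCircle.coe_add] using h

/-- A Lipschitz function on the circle is differentiable almost everywhere. -/
theorem ae_differentiableAt {d : ℕ} (c : W1 d) :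
    ∀ᵐ θ : S1, DifferentiableAt ℝ (fun x : ℝ => c (θ + (x : S1))) 0 := by
  obtain ⟨K, hK⟩ := c.exists_lipschitz
  have h1 : ∀ᵐ y : ℝ, DifferentiableAt ℝ (fun x : ℝ => c (x : S1)) y :=
    (lipschitz_lift hK).ae_differentiableAt
  have hmeas : MeasurableSet {θ : S1 | DifferentiableAt ℝ (fun x : ℝ => c (θ + (x : S1))) 0} := by
    have : {θ : S1 | DifferentiableAt ℝ (fun x : ℝ => c (θ + (x : S1))) 0} =
        rep ⁻¹' {y : ℝ | DifferentiableAt ℝ (fun x : ℝ => c (x : S1)) y} := by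
      ext θ
      have := differentiableAt_iff (c : S1 → Euc d) (rep θ)
      rw [coe_rep] at this
      exact this
    rw [this]
    exact measurable_rep (measurableSet_of_differentiableAt ℝ fun x : ℝ => c (x : S1))
  rw [← (AddCircle.measurePreserving_mk (2 * Real.pi) 0).map_eq,
    ae_map_iff AddCircle.measurable_mk'.aemeasurable hmeas]
  exact ae_restrict_of_ae (h1.mono fun y hy => (differentiableAt_iff _ y).2 hy)

theorem memLp_dTheta {d : ℕ} (c : W1 d) :
    MemLp (dTheta (c : S1 → Euc d)) ∞ (volume : Measure S1) := by
  obtain ⟨K, hK⟩ := c.exists_lipschitz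
  exact memLp_top_of_bound (measurable_dTheta _).aestronglyMeasurable K
    (Filter.Eventually.of_forall (norm_dTheta_le hK))

theorem dTheta_add {d : ℕ} (c h : W1 d) :
    dTheta ((c + h : W1 d) : S1 → Euc d) =ᵐ[volume]
      dTheta (c : S1 → Euc d) + dTheta (h : S1 → Euc d) := by
  filter_upwards [ae_differentiableAt c, ae_differentiableAt h] with θ hc hh
  exact deriv_add hc hh

theorem dTheta_smul {d : ℕ} (r : ℝ) (c : W1 d) :
    dTheta ((r • c : W1 d) : S1 → Euc d) =ᵐ[volume] r • dTheta (c : S1 → Euc d) := by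
  filter_upwards [ae_differentiableAt c] with θ hc
  exact deriv_const_smul r hc

/-- The class of `c_θ` in `L^∞`, as a linear function of `c`. -/
noncomputable def derivLp (d : ℕ) : W1 d →ₗ[ℝ] Lp (Euc d) ∞ (volume : Measure S1) where
  toFun c := (memLp_dTheta c).toLp
  map_add' c h := by
    rw [← MemLp.toLp_add]
    exact MemLp.toLp_congr _ _ (dTheta_add c h)
  map_smul' r c := by
    rw [RingHom.id_apply, ← MemLp.toLp_const_smul]
    exact MemLp.toLp_congr _ _ (dTheta_smul r c)

/-- A Lipschitz function as a continuous function. -/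
noncomputable def toCont (d : ℕ) : W1 d →ₗ[ℝ] C(S1, Euc d) where
  toFun c := ⟨c, by obtain ⟨K, hK⟩ := c.exists_lipschitz; exact hK.continuous⟩
  map_add' _ _ := rfl
  map_smul' _ _ := rfl

/-- The norm `‖c‖_{L^∞} + ‖c_θ‖_{L^∞}` of `W^{1,∞}`. -/
noncomputable def W1.addGroupNorm (d : ℕ) : AddGroupNorm (W1 d) where
  toFun c := ‖toCont d c‖ + ‖derivLp d c‖
  map_zero' := by simp
  add_le' c h := by
    rw [map_add, map_add]
    linarith [norm_add_le (toCont d c) (toCont d h), norm_add_le (derivLp d c) (derivLp d h)]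
  neg' c := by rw [map_neg, map_neg, norm_neg, norm_neg]
  eq_zero_of_map_eq_zero' c hc := by
    have h0 : toCont d c = 0 := by
      rw [← norm_eq_zero]
      linarith [norm_nonneg (toCont d c), norm_nonneg (derivLp d c)]
    exact DFunLike.ext _ _ fun θ => congrArg (fun f : C(S1, Euc d) => f θ) h0

noncomputable instance (d : ℕ) : NormedAddCommGroup (W1 d) :=
  (W1.addGroupNorm d).toNormedAddCommGroup

theorem W1.norm_def {d : ℕ} (c : W1 d) : ‖c‖ = ‖toCont d c‖ + ‖derivLp d c‖ := rfl

noncomputable instance (d : ℕ) : NormedSpace ℝ (W1 d) where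
  norm_smul_le r c := by
    rw [W1.norm_def, W1.norm_def, map_smul, map_smul, norm_smul, norm_smul, mul_add]

theorem W1.continuous_coe {d : ℕ} (c : W1 d) : Continuous (c : S1 → Euc d) := (toCont d c).continuous

theorem W1.integrable {d : ℕ} (c : W1 d) : Integrable (c : S1 → Euc d) volume :=
  c.continuous_coe.integrable_of_hasCompactSupport (HasCompactSupport.of_compactSpace _)

/-- `W^{1,∞}_0 ≅ W^{1,∞}/Tra`: the functions in `W^{1,∞}` with `∫ c dθ = 0`. -/
noncomputable def W10 (d : ℕ) : Submodule ℝ (W1 d) where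
  carrier := {c | ∫ θ : S1, c θ = 0}
  add_mem' := by
    intro a b ha hb
    have : ∫ θ : S1, (a + b) θ = (∫ θ : S1, a θ) + ∫ θ : S1, b θ :=
      integral_add a.integrable b.integrable
    rw [mem_ofPred_eq] at ha hb ⊢
    rw [this, ha, hb, add_zero]
  zero_mem' := integral_zero S1 (Euc d)
  smul_mem' := by
    intro r a ha
    have : ∫ θ : S1, (r • a) θ = r • ∫ θ : S1, a θ := integral_smul r _
    rw [mem_ofPred_eq] at ha ⊢
    rw [this, ha, smul_zero]

/-- `𝓘^{1,∞}_0 ≅ 𝓘^{1,∞}/Tra`: the Lipschitz immersions in `W^{1,∞}_0`, i.e. those `c` for which the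
essential infimum of `|c_θ|` is positive. -/
def Imm0 (d : ℕ) : Set (W10 d) :=
  {c | ∃ m : ℝ, 0 < m ∧ ∀ᵐ θ : S1, m ≤ ‖dTheta (c : W1 d) θ‖}

/-- The length `ℓ_c = ∫ |c_θ| dθ`. -/
noncomputable def length {d : ℕ} (c : W1 d) : ℝ := ∫ θ : S1, ‖dTheta c θ‖

/-- The arc length derivative `D_s h = |c_θ|⁻¹ h_θ` with respect to the curve `c`. -/
noncomputable def Ds {d : ℕ} (c h : W1 d) (θ : S1) : Euc d := ‖dTheta c θ‖⁻¹ • dTheta h θ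

/-- The metric `G_c(h,k) = ℓ_c⁻¹ ∫ ⟨D_s h, D_s k⟩ ds`, where `ds = |c_θ| dθ`. -/
noncomputable def G {d : ℕ} (c h k : W1 d) : ℝ :=
  (length c)⁻¹ * ∫ θ : S1, ⟪Ds c h θ, Ds c k θ⟫ * ‖dTheta c θ‖

/-- The `L²(ds)`-orthogonal projection `π₀ f = f - ℓ_c⁻¹ ∫ f ds` onto the functions with vanishing
integral with respect to `ds`. -/
noncomputable def piZero {d : ℕ} (c : W1 d) (f : S1 → Euc d) (θ : S1) : Euc d :=
  f θ - (length c)⁻¹ • ∫ η : S1, ‖dTheta c η‖ • f η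

/-- The arc length primitive `θ ↦ ∫_0^θ f ds` for `θ ∈ [0, 2π)`. -/
noncomputable def arcPrimitive {d : ℕ} (c : W1 d) (f : S1 → Euc d) (θ : S1) : Euc d :=
  ∫ y in (0 : ℝ)..rep θ, ‖dTheta c (y : S1)‖ • f (y : S1)

/-- The inverse of `D_s : W^{1,∞}_0 → {f ∈ L^∞ : ∫ f ds = 0}`: the arc length primitive, made
mean-free with respect to `dθ`. -/
noncomputable def DsInv {d : ℕ} (c : W1 d) (f : S1 → Euc d) (θ : S1) : Euc d :=
  arcPrimitive c f θ - (2 * Real.pi)⁻¹ • ∫ ζ : S1, arcPrimitive c f ζ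

/-- The right-hand side of the geodesic equation,
`G_c(c,u) u - ½ G_c(u,u) c + D_s⁻¹ π₀ (⟨D_s c, D_s u⟩ D_s u - ½ |D_s u|² D_s c)`. -/
noncomputable def geodesicRHS {d : ℕ} (c u : W1 d) (θ : S1) : Euc d :=
  G c c u • u θ - ((1 / 2 : ℝ) * G c u u) • c θ +
    DsInv c (piZero c fun η =>
      ⟪Ds c c η, Ds c u η⟫ • Ds c u η - ((1 / 2 : ℝ) * ‖Ds c u η‖ ^ 2) • Ds c c η) θ

/-- `c : J → 𝓘^{1,∞}_0` solves the geodesic equation `c_tt = geodesicRHS c c_t` on the time interval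
`J`, and `u = c_t` is its velocity. The time derivatives are taken in the Banach space
`W^{1,∞}_0`. -/
structure IsGeodesicOn {d : ℕ} (J : Set ℝ) (c u : ℝ → W10 d) : Prop where
  mem : ∀ t ∈ J, c t ∈ Imm0 d
  velocity : ∀ t ∈ J, HasDerivWithinAt c (u t) J t
  acceleration : ∀ t ∈ J, ∃ a : W10 d, HasDerivWithinAt u a J t ∧
    ∀ θ : S1, (a : W1 d) θ = geodesicRHS (c t : W1 d) (u t : W1 d) θ

/-- Some geodesic, defined on an open interval containing `0` and `t`, has initial position `c₀` and
initial velocity `h₀` and has position `x` at time `t`. -/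
def GeodesicReaches {d : ℕ} (t : ℝ) (c₀ h₀ x : W10 d) : Prop :=
  ∃ (J : Set ℝ) (c u : ℝ → W10 d), IsOpen J ∧ J.OrdConnected ∧ 0 ∈ J ∧ t ∈ J ∧
    IsGeodesicOn J c u ∧ c 0 = c₀ ∧ u 0 = h₀ ∧ c t = x

/-- The maximal flow domain: all `(t, c₀, h₀)` for which the solution with initial position `c₀` and
initial velocity `h₀` exists up to time `t`. -/
def flowDomain (d : ℕ) : Set (ℝ × W10 d × W10 d) :=
  {q | ∃ x, GeodesicReaches q.1 q.2.1 q.2.2 x}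

open Classical in
/-- The position at time `t` of the solution with initial position `c₀` and initial velocity `h₀`,
for `(t, c₀, h₀)` in the flow domain (and `0` elsewhere). -/
noncomputable def geodesicFlow {d : ℕ} (q : ℝ × W10 d × W10 d) : W10 d :=
  if h : ∃ x, GeodesicReaches q.1 q.2.1 q.2.2 x then h.choose else 0

/-- The domain of the exponential mapping: the solution exists up to time `1`. -/
def expDomain (d : ℕ) : Set (W10 d × W10 d) := {p | (1, p) ∈ flowDomain d}

/-- The Riemannian exponential mapping `(c, h) ↦ exp_c h`. -/
noncomputable def expMap {d : ℕ} (p : W10 d × W10 d) : W10 d := geodesicFlow (1, p)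

end LipschitzCurve

open LipschitzCurve

/-!
The geodesic equation is an ordinary differential equation on the open subset
`𝓘^{1,∞}_0 × W^{1,∞}_0` of a Banach space, with a smooth vector field `(c, u) ↦ (u, spray c u)`.
Everything then follows from the theory of such equations.

*Smoothness of the vector field.* The derivative `c ↦ c_θ` maps `W^{1,∞}_0` continuously into the
Banach space `L^∞`, and taking the mean-free primitive is a continuous linear left inverse
(`primitive_derivCLM`); in particular `W^{1,∞}_0` is complete (`completeSpace_W10`). The right-hand
side of the geodesic equation is composed of these two maps, bounded bilinear pointwise operations,
integrals, and the two nonlinear maps `f ↦ |f|` and `n ↦ n⁻¹` on functions bounded away from zero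
(`spray_apply`). On `L^∞` the former is the local inverse of squaring applied to `⟨f, f⟩`
(`Linfty.contDiffAt_normLp`) and the latter is inversion of multiplication operators
(`Linfty.contDiffAt_recip`), so that the spray is smooth (`contDiffAt_spray`).

*Smoothness of the flow.* For a smooth vector field `F` on an open subset of a Banach space, the
solutions run at speed `t` with initial value `x` are the zeros `γ ∈ C([a, b], E)` of
`γ - x - t ∫₀ F(γ)`. This map is smooth because composition with a smooth function is a smooth
operator on continuous curves (`SmoothODE.contDiffOn_nemytskii`), and its derivative in `γ` is the
identity minus a quasinilpotent Volterra operator, hence invertible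
(`SmoothODE.isUnit_one_sub_volterra`). The implicit function theorem applies along a whole given
solution and yields at once that the domain of the flow is open and that the flow is smooth, jointly
in time and initial value (`SmoothODE.exists_contDiffAt_flow`).

*The exponential mapping.* The spray is quadratic in the velocity, so `exp_c (s h)` is the geodesic
with initial velocity `h` at time `s`, and the derivative of `exp` on the zero section is
`(k, h) ↦ k + h` (`fderiv_expMap_zero`). Hence `(c, h) ↦ (c, exp_c h)` has invertible derivative on an
open neighbourhood of the zero section, and the inverse function theorem applies there.
-/

/-! ### Composition operators on spaces of continuous functions -/

namespace SmoothODE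

universe w

section Nemytskii

variable {K : Type*} [TopologicalSpace K]
variable {E E' : Type w} [NormedAddCommGroup E] [NormedAddCommGroup E']

open Classical in
/-- The composition operator `γ ↦ F ∘ γ` on `C(K, E)`. As `F` is only assumed to be continuous on
some open set, the value is `0` where `F ∘ γ` is not continuous. -/
noncomputable def nemytskii (F : E → E') (γ : C(K, E)) : C(K, E') :=
  if h : Continuous (F ∘ γ) then ⟨F ∘ γ, h⟩ else 0

/-- The continuous functions with values in `O`. -/
def curvesIn (K : Type*) [TopologicalSpace K] (O : Set E) : Set C(K, E) := {γ | ∀ x, γ x ∈ O}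

theorem nemytskii_apply {F : E → E'} {O : Set E} (hF : ContinuousOn F O) {γ : C(K, E)}
    (hγ : γ ∈ curvesIn K O) (x : K) : nemytskii F γ x = F (γ x) := by
  have h : Continuous (F ∘ γ) := hF.comp_continuous γ.continuous hγ
  simp [nemytskii, h]

theorem isOpen_curvesIn [CompactSpace K] {O : Set E} (hO : IsOpen O) : IsOpen (curvesIn K O) := by
  have := ContinuousMap.isOpen_setOfPred_mapsTo (X := K) (Y := E) isCompact_univ hO
  convert this using 1
  ext γ
  simp [curvesIn, MapsTo]

variable [CompactSpace K]

/-- A function which is continuous on an open set is continuous at the points of the image of a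
compact space, uniformly in these points. -/
theorem exists_uniform_ball {F : E → E'} {O : Set E} (hO : IsOpen O) (hF : ContinuousOn F O)
    {γ : C(K, E)} (hγ : γ ∈ curvesIn K O) {ε : ℝ} (hε : 0 < ε) :
    ∃ δ > 0, ∀ x, ∀ y ∈ Metric.ball (γ x) δ, y ∈ O ∧ ‖F y - F (γ x)‖ < ε := by
  have hc : IsCompact (range γ) := isCompact_range γ.continuous
  have hsub : range γ ⊆ O := by rintro _ ⟨x, rfl⟩; exact hγ x
  obtain ⟨δ₁, hδ₁, h₁⟩ := hc.exists_thickening_subset_open hO hsub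
  have h₂ := hc.uniformContinuousAt_of_continuousAt F
    (fun a ha => hF.continuousAt (hO.mem_nhds (hsub ha))) (Metric.dist_mem_uniformity hε)
  obtain ⟨δ₂, hδ₂, h₂⟩ := Metric.mem_uniformity_dist.1 h₂
  refine ⟨min δ₁ δ₂, lt_min hδ₁ hδ₂, fun x y hy => ⟨h₁ ?_, ?_⟩⟩
  · exact Metric.mem_thickening_iff.2 ⟨γ x, ⟨x, rfl⟩, (Metric.mem_ball.1 hy).trans_le (min_le_left _ _)⟩
  · have := h₂ (a := γ x) (b := y) ((Metric.mem_ball'.1 hy).trans_le (min_le_right _ _)) ⟨x, rfl⟩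
    rw [← dist_eq_norm, dist_comm]
    exact this

theorem continuousOn_nemytskii {F : E → E'} {O : Set E} (hO : IsOpen O) (hF : ContinuousOn F O) :
    ContinuousOn (nemytskii (K := K) F) (curvesIn K O) := by
  refine fun γ hγ => ContinuousAt.continuousWithinAt (Metric.continuousAt_iff.2 fun ε hε => ?_)
  obtain ⟨δ, hδ, h⟩ := exists_uniform_ball hO hF hγ (half_pos hε)
  refine ⟨δ, hδ, fun {η} hη => ?_⟩
  have hη' : ∀ x, η x ∈ Metric.ball (γ x) δ := fun x => (η.dist_apply_le_dist x).trans_lt hη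
  refine lt_of_le_of_lt ((ContinuousMap.dist_le (half_pos hε).le).2 fun x => ?_) (half_lt_self hε)
  rw [nemytskii_apply hF hγ, nemytskii_apply hF (fun x => (h x _ (hη' x)).1), dist_eq_norm]
  exact (h x _ (hη' x)).2.le

variable [NormedSpace ℝ E] [NormedSpace ℝ E']

/-- Pointwise application of a continuous family of operators, as a continuous bilinear map. -/
noncomputable def applyCLM (K : Type*) [TopologicalSpace K] [CompactSpace K]
    (E E' : Type*) [NormedAddCommGroup E] [NormedSpace ℝ E]
    [NormedAddCommGroup E'] [NormedSpace ℝ E'] :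
    C(K, E →L[ℝ] E') →L[ℝ] C(K, E) →L[ℝ] C(K, E') :=
  LinearMap.mkContinuous₂
    (LinearMap.mk₂ ℝ (fun (A : C(K, E →L[ℝ] E')) (h : C(K, E)) =>
        (⟨fun x => A x (h x), A.continuous.clm_apply h.continuous⟩ : C(K, E')))
      (fun _ _ _ => rfl) (fun _ _ _ => rfl)
      (fun A h k => by ext x; exact map_add (A x) _ _)
      (fun c A h => by ext x; exact map_smul (A x) _ _)) 1 (by
    intro A h
    rw [ContinuousMap.norm_le _ (by positivity)]
    intro x
    rw [one_mul]
    exact (A x).le_opNorm_of_le (h.norm_coe_le_norm x) |>.trans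
      (by gcongr; exact A.norm_coe_le_norm x))

@[simp] theorem applyCLM_apply (A : C(K, E →L[ℝ] E')) (h : C(K, E)) (x : K) :
    applyCLM K E E' A h x = A x (h x) := rfl

theorem hasFDerivAt_nemytskii {F : E → E'} {O : Set E} (hO : IsOpen O) (hF : DifferentiableOn ℝ F O)
    (hF' : ContinuousOn (fderiv ℝ F) O) {γ : C(K, E)} (hγ : γ ∈ curvesIn K O) :
    HasFDerivAt (nemytskii F) (applyCLM K E E' (nemytskii (fderiv ℝ F) γ)) γ := by
  rw [hasFDerivAt_iff_isLittleO, Asymptotics.isLittleO_iff]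
  intro ε hε
  obtain ⟨δ, hδ, h⟩ := exists_uniform_ball hO hF' hγ hε
  filter_upwards [Metric.ball_mem_nhds γ hδ] with η hη
  have hη' : ∀ x, η x ∈ Metric.ball (γ x) δ := fun x => (η.dist_apply_le_dist x).trans_lt hη
  refine (ContinuousMap.norm_le _ (by positivity)).2 fun x => ?_
  have key := (convex_ball (γ x) δ).norm_image_sub_le_of_norm_hasFDerivWithin_le'
    (f := F) (f' := fderiv ℝ F) (φ := fderiv ℝ F (γ x)) (C := ε) (x := γ x) (y := η x)
    (fun y hy => ((hF y (h x y hy).1).differentiableAt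
      (hO.mem_nhds (h x y hy).1)).hasFDerivAt.hasFDerivWithinAt)
    (fun y hy => (h x y hy).2.le) (Metric.mem_ball_self hδ) (hη' x)
  simp only [ContinuousMap.sub_apply, applyCLM_apply]
  rw [nemytskii_apply hF.continuousOn hγ, nemytskii_apply hF' hγ,
    nemytskii_apply hF.continuousOn (fun x => (h x _ (hη' x)).1)]
  exact key.trans (by gcongr; exact (η - γ).norm_coe_le_norm x)

theorem contDiffOn_nat_nemytskii {O : Set E} (hO : IsOpen O) (n : ℕ) :
    ∀ {E' : Type w} [NormedAddCommGroup E'] [NormedSpace ℝ E'] {F : E → E'},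
      ContDiffOn ℝ n F O → ContDiffOn ℝ n (nemytskii (K := K) F) (curvesIn K O) := by
  induction n with
  | zero =>
    intro E' _ _ F hF
    simp only [Nat.cast_zero, contDiffOn_zero] at hF ⊢
    exact continuousOn_nemytskii hO hF
  | succ n ih =>
    intro E' _ _ F hF
    rw [Nat.cast_add, Nat.cast_one, contDiffOn_succ_iff_fderiv_of_isOpen hO] at hF
    rw [Nat.cast_add, Nat.cast_one, contDiffOn_succ_iff_fderiv_of_isOpen (isOpen_curvesIn hO)]
    have hd := fun γ (hγ : γ ∈ curvesIn K O) =>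
      hasFDerivAt_nemytskii hO hF.1 hF.2.2.continuousOn hγ
    refine ⟨fun γ hγ => (hd γ hγ).differentiableAt.differentiableWithinAt, by simp, ?_⟩
    have hA : ContDiffOn ℝ n (fun γ => applyCLM K E E' (nemytskii (fderiv ℝ F) γ))
        (curvesIn K O) := by
      have h1 := ih hF.2.2
      have h2 : ContDiff ℝ n (fun A => applyCLM K E E' A) := by fun_prop
      exact h2.comp_contDiffOn h1
    exact hA.congr fun γ hγ => (hd γ hγ).fderiv

/-- Composition with a smooth function is a smooth operator on the space of continuous functions. -/
theorem contDiffOn_nemytskii {F : E → E'} {O : Set E} (hO : IsOpen O) (hF : ContDiffOn ℝ ∞ F O) :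
    ContDiffOn ℝ ∞ (nemytskii (K := K) F) (curvesIn K O) :=
  contDiffOn_infty.2 fun n => contDiffOn_nat_nemytskii hO n (contDiffOn_infty.1 hF n)

end Nemytskii

end SmoothODE

/-! ### The Volterra operator -/

namespace SmoothODE

section Volterra

variable {E : Type*} [NormedAddCommGroup E] [NormedSpace ℝ E] {a b : ℝ}

theorem continuous_primitive (h : a ≤ b) (g : C(Icc a b, E)) [CompleteSpace E] :
    Continuous fun s : ℝ => ∫ r in (0 : ℝ)..s, IccExtend h g r :=
  continuous_iff_continuousAt.2 fun _ =>
    (intervalIntegral.integral_hasDerivAt_right (g.continuous.Icc_extend' (h := h) |>.intervalIntegrable _ _)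
      ((g.continuous.Icc_extend' (h := h)).stronglyMeasurableAtFilter _ _)
      (g.continuous.Icc_extend' (h := h)).continuousAt).continuousAt

variable [CompleteSpace E]

/-- The Volterra operator `g ↦ (s ↦ ∫₀ˢ g)` on `C([a, b], E)`; the integrand is extended by constants
beyond the end points. -/
noncomputable def volterra (h : a ≤ b) : C(Icc a b, E) →L[ℝ] C(Icc a b, E) :=
  LinearMap.mkContinuous
    { toFun := fun g => ⟨fun s => ∫ r in (0 : ℝ)..s, IccExtend h g r,
        (continuous_primitive h g).comp continuous_subtype_val⟩
      map_add' := fun f g => by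
        ext s
        exact intervalIntegral.integral_add (f.continuous.Icc_extend' (h := h) |>.intervalIntegrable _ _)
          (g.continuous.Icc_extend' (h := h) |>.intervalIntegrable _ _)
      map_smul' := fun c g => by
        ext s
        exact intervalIntegral.integral_smul c _ } (max |a| |b|) (by
    intro g
    rw [ContinuousMap.norm_le _ (by positivity)]
    intro s
    have := intervalIntegral.norm_integral_le_of_norm_le_const (a := 0) (b := (s : ℝ))
      (f := IccExtend h g) (C := ‖g‖) (fun r _ => g.norm_coe_le_norm _)
    refine this.trans ?_
    rw [mul_comm, sub_zero]
    gcongr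
    exact abs_le_max_abs_abs s.2.1 s.2.2)

/-- The iterates of `h ↦ t ∫₀ˢ A h` satisfy the factorial bound which makes the operator
quasinilpotent. -/
theorem norm_volterra_pow_apply_le (h : a ≤ b) (ha : a ≤ 0) (hb : 0 ≤ b) (t : ℝ)
    {A : C(Icc a b, E →L[ℝ] E)} {M : ℝ} (hM : 0 ≤ M) (hA : ∀ s, ‖A s‖ ≤ M)
    (g : C(Icc a b, E)) (n : ℕ) (s : Icc a b) :
    ‖((t • (volterra h).comp (applyCLM (Icc a b) E E A)) ^ n) g s‖ ≤
      (|t| * M * |(s : ℝ)|) ^ n / n.factorial * ‖g‖ := by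
  induction n generalizing s with
  | zero => simpa using g.norm_coe_le_norm s
  | succ n ih =>
    rw [pow_succ', mul_apply_eq_comp]
    set G := ((t • (volterra h).comp (applyCLM (Icc a b) E E A)) ^ n) g
    change ‖t • ∫ r in (0 : ℝ)..s, IccExtend h (applyCLM (Icc a b) E E A G) r‖ ≤ _
    have hpt : ∀ r ∈ uIoc (0 : ℝ) s, ‖IccExtend h (applyCLM (Icc a b) E E A G) r‖ ≤
        M * ((|t| * M * |r|) ^ n / n.factorial * ‖g‖) := by
      intro r hr
      have hr' : r ∈ Icc a b := by
        have := uIoc_subset_uIcc hr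
        exact uIcc_subset_Icc ⟨ha, hb⟩ s.2 this
      rw [IccExtend_of_mem _ _ hr', applyCLM_apply]
      exact ((A _).le_opNorm _).trans
        (mul_le_mul (hA _) (ih ⟨r, hr'⟩) (norm_nonneg _) hM)
    have hint : ‖∫ r in (0 : ℝ)..s, IccExtend h (applyCLM (Icc a b) E E A G) r‖ ≤
        M * ((|t| * M) ^ n / n.factorial * ‖g‖) * (|(s : ℝ)| ^ (n + 1) / (n + 1)) := by
      have hI : |∫ r in (0 : ℝ)..s, |r| ^ n| = |(s : ℝ)| ^ (n + 1) / (n + 1) := by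
        rcases le_total 0 (s : ℝ) with hs | hs
        · rw [intervalIntegral.integral_congr (g := fun r => r ^ n)]
          · simp [abs_div, abs_of_nonneg (show (0 : ℝ) ≤ n + 1 by positivity)]
          · intro r hr
            rw [uIcc_of_le hs] at hr
            simp [abs_of_nonneg hr.1]
        · rw [intervalIntegral.integral_congr (g := fun r => (-r) ^ n)]
          · rw [intervalIntegral.integral_comp_neg fun r => r ^ n]
            simp [abs_div, abs_of_nonneg (show (0 : ℝ) ≤ n + 1 by positivity)]
          · intro r hr
            rw [uIcc_of_ge hs] at hr
            simp [abs_of_nonpos hr.2]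
      rw [← hI, ← abs_of_nonneg (show 0 ≤ M * ((|t| * M) ^ n / n.factorial * ‖g‖) by positivity),
        ← abs_mul, ← intervalIntegral.integral_const_mul]
      refine intervalIntegral.norm_integral_le_abs_of_norm_le ?_ ?_
      · refine (ae_restrict_mem measurableSet_uIoc).mono fun r hr => (hpt r hr).trans_eq ?_
        ring
      · exact (by fun_prop : Continuous fun r : ℝ => _ * |r| ^ n).intervalIntegrable _ _
    rw [norm_smul, Real.norm_eq_abs]
    refine (mul_le_mul_of_nonneg_left hint (abs_nonneg t)).trans_eq ?_
    rw [Nat.factorial_succ]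
    push_cast
    field_simp
    ring

/-- If some sequence bounding the norms of the powers of `T` tends to zero, the Neumann series
argument applies to a power of `T`, and `1 - T` is invertible. -/
theorem isUnit_one_sub_of_norm_pow_le {X : Type*} [NormedAddCommGroup X] [NormedSpace ℝ X]
    [CompleteSpace X] {T : X →L[ℝ] X} {u : ℕ → ℝ} (hT : ∀ n, ‖T ^ n‖ ≤ u n)
    (hu : Filter.Tendsto u Filter.atTop (𝓝 0)) : IsUnit (1 - T) := by
  obtain ⟨n, hn⟩ := (hu.eventually_lt_const one_pos).exists
  have hu : IsUnit (1 - T ^ n) := isUnit_one_sub_of_norm_lt_one ((hT n).trans_lt hn)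
  have hc : Commute (1 - T) (∑ i ∈ Finset.range n, T ^ i) :=
    (Commute.one_left _).sub_left (Commute.sum_right _ _ _ fun i _ => Commute.self_pow T i)
  refine (hc.isUnit_mul_iff.1 ?_).1
  rwa [mul_neg_geom_sum]

/-- Volterra integral equations of the second kind are uniquely solvable. -/
theorem isUnit_one_sub_volterra (h : a ≤ b) (ha : a ≤ 0) (hb : 0 ≤ b) (t : ℝ)
    (A : C(Icc a b, E →L[ℝ] E)) :
    IsUnit (1 - t • (volterra h).comp (applyCLM (Icc a b) E E A)) := by
  have hA := A.norm_coe_le_norm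
  have hM : 0 ≤ ‖A‖ := (norm_nonneg _).trans (hA ⟨0, ha, hb⟩)
  refine isUnit_one_sub_of_norm_pow_le (fun n => ?_)
    (FloorSemiring.tendsto_pow_div_factorial_atTop (|t| * ‖A‖ * max |a| |b|))
  refine ContinuousLinearMap.opNorm_le_bound _ (by positivity) fun g => ?_
  refine (ContinuousMap.norm_le _ (by positivity)).2 fun s => ?_
  refine (norm_volterra_pow_apply_le h ha hb t hM hA g n s).trans ?_
  have := abs_le_max_abs_abs s.2.1 s.2.2
  gcongr

end Volterra

end SmoothODE

/-! ### Uniqueness of solutions on intervals -/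

theorem Set.OrdConnected.preimage_const_mul {J : Set ℝ} (hJ : J.OrdConnected) (r : ℝ) :
    ((fun t => r * t) ⁻¹' J).OrdConnected := by
  rcases le_total 0 r with hr | hr
  · exact hJ.preimage_mono fun _ _ h => mul_le_mul_of_nonneg_left h hr
  · exact hJ.preimage_anti fun _ _ h => mul_le_mul_of_nonpos_left h hr

namespace SmoothODE

universe w

section Solutions

variable {E : Type w} [NormedAddCommGroup E] [NormedSpace ℝ E]

/-- `y : J → O` solves the autonomous equation `y' = F(y)`; at end points of `J` the derivative is
one-sided. -/
def IsSolutionOn (F : E → E) (O : Set E) (J : Set ℝ) (y : ℝ → E) : Prop :=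
  ∀ t ∈ J, y t ∈ O ∧ HasDerivWithinAt y (F (y t)) J t

theorem IsSolutionOn.mono {F : E → E} {O : Set E} {J J' : Set ℝ} {y : ℝ → E}
    (h : IsSolutionOn F O J y) (hJ : J' ⊆ J) : IsSolutionOn F O J' y :=
  fun t ht => ⟨(h t (hJ ht)).1, (h t (hJ ht)).2.mono hJ⟩

theorem IsSolutionOn.continuousOn {F : E → E} {O : Set E} {J : Set ℝ} {y : ℝ → E}
    (h : IsSolutionOn F O J y) : ContinuousOn y J :=
  fun t ht => (h t ht).2.continuousWithinAt

theorem IsSolutionOn.comp_neg {F : E → E} {O : Set E} {J J' : Set ℝ} {y : ℝ → E}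
    (h : IsSolutionOn F O J y) (hJ : MapsTo Neg.neg J' J) :
    IsSolutionOn (fun x => -F x) O J' fun t => y (-t) := by
  refine fun t ht => ⟨(h (-t) (hJ ht)).1, ?_⟩
  have := (h (-t) (hJ ht)).2.scomp t (hasDerivAt_neg t).hasDerivWithinAt hJ
  simpa [Function.comp_def] using this

theorem IsSolutionOn.eqOn_Icc {F : E → E} {O : Set E} (hO : IsOpen O) (hF : ContDiffOn ℝ 1 F O)
    {a b : ℝ} {f g : ℝ → E} (hf : IsSolutionOn F O (Icc a b) f) (hg : IsSolutionOn F O (Icc a b) g)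
    (h : f a = g a) : EqOn f g (Icc a b) := by
  refine IsClosed.Icc_subset_of_forall_mem_nhdsWithin (s := {t | f t = g t}) ?_ h ?_
  · have := (hf.continuousOn.prodMk hg.continuousOn).preimage_isClosed_of_isClosed isClosed_Icc
      isClosed_diagonal
    rwa [inter_comm] at this
  · rintro x ⟨hx, hxab⟩
    have hx : f x = g x := hx
    have hxI : x ∈ Icc a b := Ico_subset_Icc_self hxab
    obtain ⟨K, u, hu, hK⟩ :=
      (hF.contDiffAt (hO.mem_nhds (hf x hxI).1)).exists_lipschitzOnWith
    have hev : ∀ᶠ t in 𝓝[≥] x, f t ∈ u ∧ g t ∈ u := by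
      rw [← nhdsWithin_Icc_eq_nhdsGE hxab.2]
      refine Filter.Eventually.filter_mono (nhdsWithin_mono x (Icc_subset_Icc_left hxab.1)) ?_
      exact ((hf x hxI).2.continuousWithinAt.eventually_mem hu).and
        ((hg x hxI).2.continuousWithinAt.eventually_mem (hx ▸ hu))
    obtain ⟨y, hy, hyu⟩ := (mem_nhdsGE_iff_exists_Icc_subset).1 hev
    have hsub : Icc x (min y b) ⊆ Icc a b := Icc_subset_Icc hxab.1 (min_le_right _ _)
    have hd : ∀ {k : ℝ → E}, IsSolutionOn F O (Icc a b) k → ∀ t ∈ Ico x (min y b),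
        HasDerivWithinAt k (F (k t)) (Ici t) t := fun hk t ht =>
      (hk t (hsub (Ico_subset_Icc_self ht))).2.mono_of_mem_nhdsWithin
        (Icc_mem_nhdsGE_of_mem ⟨hxab.1.trans ht.1, ht.2.trans_le (min_le_right _ _)⟩)
    have huy : ∀ t ∈ Ico x (min y b), f t ∈ u ∧ g t ∈ u := fun t ht =>
      hyu ⟨ht.1, ht.2.le.trans (min_le_left _ _)⟩
    have := ODE_solution_unique_of_mem_Icc_right (v := fun _ => F) (s := fun _ => u)
      (fun _ _ => hK) (hf.continuousOn.mono hsub) (hd hf) (fun t ht => (huy t ht).1)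
      (hg.continuousOn.mono hsub) (hd hg) (fun t ht => (huy t ht).2) hx
    exact Filter.mem_of_superset (Icc_mem_nhdsGT (lt_min hy hxab.2)) this

/-- Two solutions on an interval which agree at one time agree on the interval. -/
theorem IsSolutionOn.eqOn {F : E → E} {O : Set E} (hO : IsOpen O) (hF : ContDiffOn ℝ 1 F O)
    {J : Set ℝ} (hJ : J.OrdConnected) {t₀ : ℝ} (ht₀ : t₀ ∈ J) {f g : ℝ → E}
    (hf : IsSolutionOn F O J f) (hg : IsSolutionOn F O J g) (h : f t₀ = g t₀) : EqOn f g J := by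
  intro t ht
  rcases le_total t₀ t with htt | htt
  · have hsub := hJ.out ht₀ ht
    exact (hf.mono hsub).eqOn_Icc hO hF (hg.mono hsub) h ⟨htt, le_rfl⟩
  · have hsub : MapsTo Neg.neg (Icc (-t₀) (-t)) J := fun r hr =>
      hJ.out ht ht₀ ⟨le_neg.1 hr.2, neg_le.1 hr.1⟩
    have := (hf.comp_neg hsub).eqOn_Icc hO hF.neg (hg.comp_neg hsub) (by simpa using h)
      (⟨neg_le_neg htt, le_rfl⟩ : -t ∈ Icc (-t₀) (-t))
    simpa using this

variable [CompleteSpace E]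

theorem exists_isSolutionOn {F : E → E} {O : Set E} (hO : IsOpen O) (hF : ContDiffOn ℝ 1 F O) {x : E}
    (hx : x ∈ O) : ∃ ε > 0, ∃ y, IsSolutionOn F O (Ioo (-ε) ε) y ∧ y 0 = x := by
  obtain ⟨y, hy0, ε, hε, hy⟩ := (hF.contDiffAt
    (hO.mem_nhds hx)).exists_forall_mem_closedBall_exists_eq_forall_mem_Ioo_hasDerivAt₀ 0
  simp only [zero_sub, zero_add] at hy
  have hc : ContinuousAt y 0 := (hy 0 ⟨by linarith, hε⟩).continuousAt
  obtain ⟨δ, hδ, hyδ⟩ := Metric.eventually_nhds_iff_ball.1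
    (hc.eventually_mem (hO.mem_nhds (hy0.symm ▸ hx)))
  rw [Real.ball_eq_Ioo, zero_sub, zero_add] at hyδ
  refine ⟨min ε δ, lt_min hε hδ, y, fun t ht => ⟨hyδ t ?_, (hy t ?_).hasDerivWithinAt⟩, hy0⟩
  · exact ⟨(neg_le_neg (min_le_right _ _)).trans_lt ht.1, ht.2.trans_le (min_le_right _ _)⟩
  · exact ⟨(neg_le_neg (min_le_left _ _)).trans_lt ht.1, ht.2.trans_le (min_le_left _ _)⟩

end Solutions

/-! ### Smooth dependence on time and initial value -/

section Flow

variable {E : Type w} [NormedAddCommGroup E] [NormedSpace ℝ E] [CompleteSpace E]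

/-- The Picard map `((t, x), γ) ↦ γ - x - t ∫₀ F(γ)`. Its zeros are the curves `γ` on `[a, b]` with
`γ(0) = x` and `γ' = t F(γ)`, that is, the solutions of `y' = F(y)` run at speed `t`. -/
noncomputable def picardMap (F : E → E) {a b : ℝ} (h : a ≤ b) (p : (ℝ × E) × C(Icc a b, E)) :
    C(Icc a b, E) :=
  p.2 - ContinuousMap.const _ p.1.2 - p.1.1 • volterra h (nemytskii F p.2)

theorem contDiffAt_picardMap {F : E → E} {O : Set E} (hO : IsOpen O) (hF : ContDiffOn ℝ ∞ F O)
    {a b : ℝ} (h : a ≤ b) {p : (ℝ × E) × C(Icc a b, E)} (hp : p.2 ∈ curvesIn (Icc a b) O) :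
    ContDiffAt ℝ ∞ (picardMap F h) p := by
  have h1 : ContDiffAt ℝ ∞ (nemytskii (K := Icc a b) F) p.2 :=
    (contDiffOn_nemytskii hO hF).contDiffAt ((isOpen_curvesIn hO).mem_nhds hp)
  have h2 : ContDiffAt ℝ ∞ (fun q : (ℝ × E) × C(Icc a b, E) => nemytskii F q.2) p :=
    h1.comp p contDiffAt_snd
  let L : E →L[ℝ] C(Icc a b, E) :=
    ContinuousLinearMap.mk ⟨⟨ContinuousMap.const _, fun _ _ => rfl⟩, fun _ _ => rfl⟩
      ContinuousMap.continuous_const'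
  have h3 : ContDiffAt ℝ ∞
      (fun q : (ℝ × E) × C(Icc a b, E) => ContinuousMap.const (Icc a b) q.1.2) p :=
    L.contDiff.contDiffAt.comp p (by fun_prop)
  have h4 : ContDiffAt ℝ ∞
      (fun q : (ℝ × E) × C(Icc a b, E) => volterra h (nemytskii F q.2)) p := by
    have hV : ContDiff ℝ ∞ fun g : C(Icc a b, E) => volterra h g := by fun_prop
    exact hV.contDiffAt.comp p h2
  exact (contDiffAt_snd.sub h3).sub ((contDiffAt_fst.fst).smul h4)

theorem isInvertible_fderiv_picardMap {F : E → E} {O : Set E} (hO : IsOpen O)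
    (hF : ContDiffOn ℝ ∞ F O) {a b : ℝ} (h : a ≤ b) (ha : a ≤ 0) (hb : 0 ≤ b)
    {p : (ℝ × E) × C(Icc a b, E)} (hp : p.2 ∈ curvesIn (Icc a b) O) :
    (fderiv ℝ (picardMap F h) p ∘L .inr ℝ (ℝ × E) C(Icc a b, E)).IsInvertible := by
  set A := nemytskii (K := Icc a b) (fderiv ℝ F) p.2
  have h1 : HasFDerivAt (fun γ => picardMap F h (p.1, γ))
      (1 - p.1.1 • (volterra h).comp (applyCLM (Icc a b) E E A)) p.2 := by
    have hn := hasFDerivAt_nemytskii hO (hF.differentiableOn (by simp))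
      (hF.continuousOn_fderiv_of_isOpen hO (by simp)) hp
    have hV : HasFDerivAt (fun g : C(Icc a b, E) => volterra h g) (volterra h) (nemytskii F p.2) :=
      ContinuousLinearMap.hasFDerivAt (E := C(Icc a b, E)) (F := C(Icc a b, E)) (volterra h)
    have hc : HasFDerivAt (fun γ : C(Icc a b, E) => p.1.1 • volterra h (nemytskii F γ))
        (p.1.1 • (volterra h).comp (applyCLM (Icc a b) E E A)) p.2 :=
      (hV.comp p.2 hn).const_smul p.1.1
    have hi : HasFDerivAt (fun γ : C(Icc a b, E) => γ - ContinuousMap.const _ p.1.2)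
        (1 : C(Icc a b, E) →L[ℝ] C(Icc a b, E)) p.2 := (hasFDerivAt_id p.2).sub_const _
    exact hi.sub hc
  have h2 : HasFDerivAt (fun γ => picardMap F h (p.1, γ))
      (fderiv ℝ (picardMap F h) p ∘L .inr ℝ (ℝ × E) C(Icc a b, E)) p.2 := by
    have h3 : HasFDerivAt (picardMap F h) (fderiv ℝ (picardMap F h) p) (p.1, p.2) :=
      ((contDiffAt_picardMap hO hF h hp).differentiableAt (by simp)).hasFDerivAt
    exact h3.comp p.2 (hasFDerivAt_prodMk_right p.1 p.2)
  rw [h2.unique h1]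
  obtain ⟨e, he⟩ := isUnit_one_sub_volterra h ha hb p.1.1 A
  rw [← he]
  exact ⟨ContinuousLinearEquiv.unitsEquiv ℝ _ e, rfl⟩

/-- A zero of the Picard map is a reparametrized solution. -/
theorem exists_isSolutionOn_of_picardMap_eq_zero {F : E → E} {O : Set E} (hO : IsOpen O)
    (hF : ContDiffOn ℝ ∞ F O) {a b : ℝ} (ha : a < 0) (hb : 1 < b) (h : a ≤ b) {t : ℝ} {x : E}
    {γ : C(Icc a b, E)} (hγ : γ ∈ curvesIn (Icc a b) O) (hz : picardMap F h ((t, x), γ) = 0) :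
    ∃ (J : Set ℝ) (y : ℝ → E), IsOpen J ∧ J.OrdConnected ∧ 0 ∈ J ∧ t ∈ J ∧ IsSolutionOn F O J y ∧
      y 0 = x ∧ y t = IccExtend h γ 1 := by
  set f := IccExtend h (nemytskii F γ)
  have hf : Continuous f := (nemytskii F γ).continuous.Icc_extend'
  set z : ℝ → E := fun s => x + t • ∫ r in (0 : ℝ)..s, f r
  have hzγ : ∀ s (hs : s ∈ Icc a b), z s = γ ⟨s, hs⟩ := by
    intro s hs
    have := congrArg (fun k : C(Icc a b, E) => k ⟨s, hs⟩) hz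
    change γ ⟨s, hs⟩ - x - t • (∫ r in (0 : ℝ)..s, f r) = 0 at this
    rw [sub_sub, sub_eq_zero] at this
    exact this.symm
  have hzd : ∀ s ∈ Icc a b, HasDerivAt z (t • F (z s)) s := by
    intro s hs
    have h1 : HasDerivAt (fun s => ∫ r in (0 : ℝ)..s, f r) (f s) s :=
      intervalIntegral.integral_hasDerivAt_right (hf.intervalIntegrable _ _)
        (hf.stronglyMeasurableAtFilter _ _) hf.continuousAt
    have h2 : f s = F (z s) := by
      rw [hzγ s hs, ← nemytskii_apply hF.continuousOn hγ]
      exact IccExtend_of_mem _ _ hs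
    rw [← h2]
    exact (h1.const_smul t).const_add x
  have hz0 : z 0 = x := by simp [z]
  have h0 : (0 : ℝ) ∈ Ioo a b := ⟨ha, by linarith⟩
  have h1 : (1 : ℝ) ∈ Ioo a b := ⟨by linarith, hb⟩
  have hz1 : IccExtend h γ 1 = z 1 := by
    rw [hzγ 1 (Ioo_subset_Icc_self h1), IccExtend_of_mem]
  rw [hz1]
  rcases eq_or_ne t 0 with rfl | ht
  · have hx : x ∈ O := by
      rw [← hz0, hzγ 0 (Ioo_subset_Icc_self h0)]
      exact hγ _
    obtain ⟨ε, hε, y, hy, hy0⟩ := exists_isSolutionOn hO (hF.of_le (by simp)) hx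
    exact ⟨Ioo (-ε) ε, y, isOpen_Ioo, ordConnected_Ioo, ⟨by linarith, hε⟩, ⟨by linarith, hε⟩, hy, hy0,
      by simp [hy0, z]⟩
  · refine ⟨(fun r => t⁻¹ * r) ⁻¹' Ioo a b, fun r => z (t⁻¹ * r),
      isOpen_Ioo.preimage (by fun_prop), ordConnected_Ioo.preimage_const_mul _,
      by simpa using h0, by simpa [ht] using h1, ?_, by simpa using hz0, by simp [ht]⟩
    · intro r hr
      have hr' := Ioo_subset_Icc_self hr
      refine ⟨?_, ?_⟩
      · change z (t⁻¹ * r) ∈ O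
        rw [hzγ _ hr']
        exact hγ _
      · have := (hzd _ hr').scomp r ((hasDerivAt_id r).const_mul t⁻¹)
        simpa [Function.comp_def, smul_smul, ht] using this.hasDerivWithinAt

/-- **Smooth dependence on time and initial value.** Near `(t₀, y(0))`, where `y` is a solution up to
time `t₀`, solutions exist and their values at the prescribed time form a smooth map. The interval on
which the Picard map is set up is a little larger than `[0, 1]`, so that the solutions it produces
live on open intervals. -/
theorem exists_contDiffAt_flow {F : E → E} {O : Set E} (hO : IsOpen O) (hF : ContDiffOn ℝ ∞ F O)
    {J : Set ℝ} (hJ : IsOpen J) (hJc : J.OrdConnected) (h0 : 0 ∈ J) {t₀ : ℝ} (ht₀ : t₀ ∈ J)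
    {y : ℝ → E} (hy : IsSolutionOn F O J y) :
    ∃ σ : ℝ × E → E, ContDiffAt ℝ ∞ σ (t₀, y 0) ∧ ∀ᶠ q in 𝓝 (t₀, y 0),
      ∃ (J' : Set ℝ) (z : ℝ → E), IsOpen J' ∧ J'.OrdConnected ∧ 0 ∈ J' ∧ q.1 ∈ J' ∧
        IsSolutionOn F O J' z ∧ z 0 = q.2 ∧ z q.1 = σ q := by
  obtain ⟨a, b, ha, hb, hab⟩ : ∃ a b : ℝ, a < 0 ∧ 1 < b ∧ ∀ s ∈ Icc a b, t₀ * s ∈ J := by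
    have hS : IsOpen ((fun s => t₀ * s) ⁻¹' J) := hJ.preimage (by fun_prop)
    have e0 : ∀ᶠ s in 𝓝 (0 : ℝ), t₀ * s ∈ J := hS.mem_nhds (by simpa using h0)
    have e1 : ∀ᶠ s in 𝓝 (1 : ℝ), t₀ * s ∈ J := hS.mem_nhds (by simpa using ht₀)
    obtain ⟨a, haJ, ha⟩ := ((e0.filter_mono nhdsWithin_le_nhds).and
      (self_mem_nhdsWithin (s := Iio (0 : ℝ)))).exists
    obtain ⟨b, hbJ, hb⟩ := ((e1.filter_mono nhdsWithin_le_nhds).and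
      (self_mem_nhdsWithin (s := Ioi (1 : ℝ)))).exists
    refine ⟨a, b, ha, hb, fun s hs => ?_⟩
    rcases le_total 0 t₀ with h | h
    · exact hJc.out haJ hbJ ⟨mul_le_mul_of_nonneg_left hs.1 h, mul_le_mul_of_nonneg_left hs.2 h⟩
    · exact hJc.out hbJ haJ ⟨mul_le_mul_of_nonpos_left hs.2 h, mul_le_mul_of_nonpos_left hs.1 h⟩
  have h : a ≤ b := by linarith
  have hyc : Continuous fun s : Icc a b => y (t₀ * s) :=
    hy.continuousOn.comp_continuous (by fun_prop) fun s => hab s s.2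
  let γ₀ : C(Icc a b, E) := ⟨fun s => y (t₀ * s), hyc⟩
  have hγ₀ : γ₀ ∈ curvesIn (Icc a b) O := fun s => (hy _ (hab s s.2)).1
  let p : (ℝ × E) × C(Icc a b, E) := ((t₀, y 0), γ₀)
  have hp0 : picardMap F h p = 0 := by
    ext s
    have hsub : uIcc (0 : ℝ) s ⊆ Icc a b := uIcc_subset_Icc ⟨ha.le, by linarith⟩ s.2
    have hd : ∀ r ∈ uIcc (0 : ℝ) s, HasDerivAt (fun r => y (t₀ * r)) (t₀ • F (y (t₀ * r))) r := by
      intro r hr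
      have := ((hy _ (hab r (hsub hr))).2.hasDerivAt (hJ.mem_nhds (hab r (hsub hr)))).scomp r
        ((hasDerivAt_id r).const_mul t₀)
      simpa [Function.comp_def] using this
    have hint := intervalIntegral.integral_eq_sub_of_hasDerivAt hd (by
      refine ContinuousOn.intervalIntegrable ?_
      refine ContinuousOn.const_smul ?_ t₀
      refine hF.continuousOn.comp (fun r hr => (hd r hr).continuousAt.continuousWithinAt) ?_
      exact fun r hr => (hy _ (hab r (hsub hr))).1)
    rw [mul_zero, intervalIntegral.integral_smul] at hint
    change y (t₀ * s) - y 0 - t₀ • (∫ r in (0 : ℝ)..s, IccExtend h (nemytskii F γ₀) r) = 0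
    rw [← hint, sub_eq_zero]
    congr 1
    refine intervalIntegral.integral_congr fun r hr => ?_
    simp only [IccExtend_of_mem h _ (hsub hr)]
    rw [nemytskii_apply hF.continuousOn hγ₀]
    rfl
  have hcd := contDiffAt_picardMap hO hF h (p := p) hγ₀
  have hinv := isInvertible_fderiv_picardMap hO hF h ha.le (by linarith) (p := p) hγ₀
  let Γ := hcd.implicitFunction (by simp) hinv
  have hΓ : ContDiffAt ℝ ∞ Γ (t₀, y 0) := hcd.contDiffAt_implicitFunction (by simp) hinv
  have hΓ0 : Γ (t₀, y 0) = γ₀ := hcd.implicitFunction_apply_self (by simp) hinv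
  have hev : ∀ᶠ q in 𝓝 (t₀, y 0), picardMap F h (q, Γ q) = picardMap F h p :=
    hcd.eventually_apply_implicitFunction (by simp) hinv
  have hmem : ∀ᶠ q in 𝓝 (t₀, y 0), Γ q ∈ curvesIn (Icc a b) O :=
    hΓ.continuousAt.eventually_mem ((isOpen_curvesIn hO).mem_nhds (hΓ0.symm ▸ hγ₀))
  refine ⟨fun q => IccExtend h (Γ q) 1, ?_, ?_⟩
  · exact (ContinuousMap.evalCLM ℝ (projIcc a b h 1)).contDiff.contDiffAt.comp _ hΓ
  · filter_upwards [hev, hmem] with q hq hqO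
    exact exists_isSolutionOn_of_picardMap_eq_zero hO hF ha hb h hqO (hq.trans hp0)

end Flow

end SmoothODE

/-! ### Pointwise operations on essentially bounded functions -/

namespace Linfty

variable {α : Type*} [MeasurableSpace α]

section Operations

variable (μ : Measure α) (E : Type*) [NormedAddCommGroup E] [InnerProductSpace ℝ E]

/-- Pointwise multiplication on `L^∞(μ)`. -/
noncomputable def mulCLM : Lp ℝ ∞ μ →L[ℝ] Lp ℝ ∞ μ →L[ℝ] Lp ℝ ∞ μ :=
  (ContinuousLinearMap.mul ℝ ℝ).holderL μ ∞ ∞ ∞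

/-- Pointwise multiplication of an `E`-valued function by a real function. -/
noncomputable def smulCLM : Lp ℝ ∞ μ →L[ℝ] Lp E ∞ μ →L[ℝ] Lp E ∞ μ :=
  (ContinuousLinearMap.lsmul ℝ ℝ).holderL μ ∞ ∞ ∞

/-- The pointwise inner product of `E`-valued functions. -/
noncomputable def innerCLM : Lp E ∞ μ →L[ℝ] Lp E ∞ μ →L[ℝ] Lp ℝ ∞ μ :=
  (innerSL ℝ : E →L[ℝ] E →L[ℝ] ℝ).holderL μ ∞ ∞ ∞

variable {μ E}

theorem mulCLM_ae (f g : Lp ℝ ∞ μ) : mulCLM μ f g =ᵐ[μ] fun x => f x * g x :=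
  (ContinuousLinearMap.mul ℝ ℝ).coeFn_holder f g

theorem smulCLM_ae (f : Lp ℝ ∞ μ) (g : Lp E ∞ μ) : smulCLM μ E f g =ᵐ[μ] fun x => f x • g x :=
  (ContinuousLinearMap.lsmul ℝ ℝ : ℝ →L[ℝ] E →L[ℝ] E).coeFn_holder f g

theorem innerCLM_ae (f g : Lp E ∞ μ) : innerCLM μ E f g =ᵐ[μ] fun x => ⟪f x, g x⟫ :=
  (innerSL ℝ : E →L[ℝ] E →L[ℝ] ℝ).coeFn_holder f g

variable (μ E) in
/-- The integral as a continuous linear map on `L^∞` of a finite measure. -/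
noncomputable def integralCLM [IsFiniteMeasure μ] [CompleteSpace E] : Lp E ∞ μ →L[ℝ] E :=
  (ContinuousLinearMap.lsmul ℝ ℝ : ℝ →L[ℝ] E →L[ℝ] E).lpPairing μ 1 ∞ (Lp.const 1 μ 1)

theorem integralCLM_apply [IsFiniteMeasure μ] [CompleteSpace E] (f : Lp E ∞ μ) :
    integralCLM μ E f = ∫ x, f x ∂μ := by
  rw [integralCLM, ContinuousLinearMap.lpPairing_eq_integral]
  refine integral_congr_ae ?_
  filter_upwards [Lp.coeFn_const (p := 1) (μ := μ) (1 : ℝ)] with x hx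
  rw [hx, Function.const_apply, ContinuousLinearMap.lsmul_apply, one_smul]

end Operations

section Norm

variable {μ : Measure α} {E : Type*} [NormedAddCommGroup E]

/-- The pointwise norm of an `E`-valued function. -/
noncomputable def normLp (f : Lp E ∞ μ) : Lp ℝ ∞ μ := lipschitzWith_one_norm.compLp norm_zero f

theorem normLp_ae (f : Lp E ∞ μ) : normLp f =ᵐ[μ] fun x => ‖f x‖ :=
  LipschitzWith.coeFn_compLp lipschitzWith_one_norm norm_zero f

theorem normLp_ge_ae {f : Lp E ∞ μ} {m : ℝ} (hf : ∀ᵐ x ∂μ, m ≤ ‖f x‖) :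
    ∀ᵐ x ∂μ, m ≤ normLp f x := by
  filter_upwards [hf, normLp_ae f] with x h1 h2
  rwa [h2]

theorem continuous_normLp : Continuous (normLp : Lp E ∞ μ → Lp ℝ ∞ μ) :=
  LipschitzWith.continuous_compLp lipschitzWith_one_norm norm_zero

variable (μ E) in
/-- The functions whose pointwise norm has positive essential infimum. -/
def awayFromZero : Set (Lp E ∞ μ) := {f | ∃ m : ℝ, 0 < m ∧ ∀ᵐ x ∂μ, m ≤ ‖f x‖}

theorem ae_norm_le_norm (f : Lp E ∞ μ) : ∀ᵐ x ∂μ, ‖f x‖ ≤ ‖f‖ := by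
  have h := ae_le_eLpNormEssSup (f := f) (μ := μ)
  filter_upwards [h] with x hx
  rw [← eLpNorm_exponent_top, ← Lp.enorm_def] at hx
  rwa [← enorm_le_iff_norm_le]

theorem isOpen_awayFromZero : IsOpen (awayFromZero μ E) := by
  rw [Metric.isOpen_iff]
  rintro f ⟨m, hm, hf⟩
  refine ⟨m / 2, half_pos hm, fun g hg => ⟨m / 2, half_pos hm, ?_⟩⟩
  filter_upwards [hf, ae_norm_le_norm (g - f), Lp.coeFn_sub g f] with x h1 h2 h3
  rw [h3, Pi.sub_apply] at h2
  rw [Metric.mem_ball, dist_eq_norm] at hg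
  have := norm_sub_norm_le (f x) (g x)
  rw [norm_sub_rev] at this
  linarith

end Norm

/-! ### Smoothness of the pointwise norm and of its reciprocal -/

section Smooth

variable {μ : Measure α}

/-- Multiplication by a function with positive essential infimum is invertible; the inverse is
multiplication by the reciprocal. -/
theorem exists_mulCLM_inverse {n : Lp ℝ ∞ μ} {m : ℝ} (hm : 0 < m) (hn : ∀ᵐ x ∂μ, m ≤ n x) :
    ∃ i : Lp ℝ ∞ μ, (i =ᵐ[μ] fun x => (n x)⁻¹) ∧
      mulCLM μ n * mulCLM μ i = 1 ∧ mulCLM μ i * mulCLM μ n = 1 := by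
  have hmem : MemLp (fun x => (n x)⁻¹) ∞ μ := by
    refine memLp_top_of_bound (Lp.aestronglyMeasurable n).inv₀ m⁻¹ ?_
    filter_upwards [hn] with x hx
    rw [norm_inv, Real.norm_of_nonneg (hm.le.trans hx)]
    exact inv_anti₀ hm hx
  have hi := hmem.coeFn_toLp
  refine ⟨hmem.toLp, hi, ?_, ?_⟩ <;>
  · ext1 h
    refine Lp.ext ?_
    simp only [mul_apply_eq_comp, one_apply_eq_self]
    filter_upwards [mulCLM_ae n (mulCLM μ hmem.toLp h), mulCLM_ae hmem.toLp h,
      mulCLM_ae hmem.toLp (mulCLM μ n h), mulCLM_ae n h, hi, hn] with x h1 h2 h3 h4 h5 h6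
    have : n x ≠ 0 := (hm.trans_le h6).ne'
    simp only [h1, h2, h3, h4, h5]
    field_simp

/-- The pointwise reciprocal, as the value at `1` of the inverse of the multiplication operator. -/
noncomputable def recip [IsFiniteMeasure μ] (n : Lp ℝ ∞ μ) : Lp ℝ ∞ μ :=
  Ring.inverse (mulCLM μ n) (Lp.const ∞ μ 1)

theorem recip_ae [IsFiniteMeasure μ] {n : Lp ℝ ∞ μ} {m : ℝ} (hm : 0 < m)
    (hn : ∀ᵐ x ∂μ, m ≤ n x) : recip n =ᵐ[μ] fun x => (n x)⁻¹ := by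
  obtain ⟨i, hi, h1, h2⟩ := exists_mulCLM_inverse hm hn
  have : Ring.inverse (mulCLM μ n) = mulCLM μ i := Ring.inverse_unit ⟨_, _, h1, h2⟩
  rw [recip, this]
  filter_upwards [mulCLM_ae i (Lp.const ∞ μ 1), hi, Lp.coeFn_const (p := ∞) (μ := μ) (1 : ℝ)]
    with x h3 h4 h5
  rw [h3, h4, h5, Function.const_apply, mul_one]

theorem contDiffAt_recip [IsFiniteMeasure μ] {n : Lp ℝ ∞ μ} {m : ℝ} (hm : 0 < m)
    (hn : ∀ᵐ x ∂μ, m ≤ n x) : ContDiffAt ℝ ∞ (recip (μ := μ)) n := by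
  obtain ⟨i, -, h1, h2⟩ := exists_mulCLM_inverse hm hn
  have h : ContDiffAt ℝ ∞ Ring.inverse (mulCLM μ n) :=
    contDiffAt_ringInverse ℝ (⟨_, _, h1, h2⟩ : (Lp ℝ ∞ μ →L[ℝ] Lp ℝ ∞ μ)ˣ)
  exact (h.comp n (mulCLM μ).contDiff.contDiffAt).clm_apply contDiffAt_const

variable {E : Type*} [NormedAddCommGroup E] [InnerProductSpace ℝ E]

theorem mulCLM_normLp_self (f : Lp E ∞ μ) :
    mulCLM μ (normLp f) (normLp f) = innerCLM μ E f f := by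
  refine Lp.ext ?_
  filter_upwards [mulCLM_ae (normLp f) (normLp f), innerCLM_ae f f, normLp_ae f] with x h1 h2 h3
  rw [h1, h2, h3, real_inner_self_eq_norm_mul_norm]

/-- The pointwise norm is smooth where it is bounded away from zero: there it is the composition of
`f ↦ ⟨f, f⟩` with a local inverse of squaring on `L^∞`. -/
theorem contDiffAt_normLp {f : Lp E ∞ μ} (hf : f ∈ awayFromZero μ E) :
    ContDiffAt ℝ ∞ (normLp (μ := μ) (E := E)) f := by
  obtain ⟨m, hm, hfm⟩ := hf
  obtain ⟨i, -, h1, h2⟩ := exists_mulCLM_inverse hm (normLp_ge_ae hfm)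
  let sq : Lp ℝ ∞ μ → Lp ℝ ∞ μ := fun n => mulCLM μ n n
  have hsq : ContDiff ℝ ∞ sq := (mulCLM μ).contDiff.clm_apply contDiff_id
  let u : (Lp ℝ ∞ μ →L[ℝ] Lp ℝ ∞ μ)ˣ := ⟨_, _, h1, h2⟩
  let e : Lp ℝ ∞ μ ≃L[ℝ] Lp ℝ ∞ μ :=
    ContinuousLinearEquiv.unitsEquiv ℝ _ (Units.mk0 (2 : ℝ) two_ne_zero • u)
  have he : HasFDerivAt sq (e : Lp ℝ ∞ μ →L[ℝ] Lp ℝ ∞ μ) (normLp f) := by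
    have := (mulCLM μ).hasFDerivAt (x := normLp f) |>.clm_apply (hasFDerivAt_id (normLp f))
    refine this.congr_fderiv (ContinuousLinearMap.ext fun h => ?_)
    have hc : mulCLM μ h (normLp f) = mulCLM μ (normLp f) h := by
      refine Lp.ext ?_
      filter_upwards [mulCLM_ae h (normLp f), mulCLM_ae (normLp f) h] with x h3 h4
      rw [h3, h4, mul_comm]
    change mulCLM μ (normLp f) h + mulCLM μ h (normLp f) =
      (2 : ℝ) • mulCLM μ (normLp f) h
    rw [hc, two_smul]
  have hinv := hsq.contDiffAt.to_localInverse he (by simp)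
  have hleft := (hsq.contDiffAt.hasStrictFDerivAt' he (by simp)).eventually_left_inverse
  have hev := continuous_normLp.continuousAt.eventually hleft
  have hcomp : ContDiffAt ℝ ∞ (fun g : Lp E ∞ μ =>
      hsq.contDiffAt.localInverse he (by simp) (innerCLM μ E g g)) f := by
    have hi : ContDiffAt ℝ ∞ (fun g : Lp E ∞ μ => innerCLM μ E g g) f :=
      (innerCLM μ E).contDiff.contDiffAt.clm_apply contDiffAt_id
    refine ContDiffAt.comp f ?_ hi
    rw [← mulCLM_normLp_self]
    exact hinv
  refine hcomp.congr_of_eventuallyEq ?_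
  filter_upwards [hev] with g hg
  rw [← mulCLM_normLp_self]
  exact hg.symm

end Smooth

end Linfty

/-! ### Primitives of essentially bounded functions on the circle -/

namespace LipschitzCurve

/-- `L^∞(S¹, ℝ^d)`. -/
abbrev Linf (d : ℕ) : Type := Lp (Euc d) ∞ (volume : Measure S1)

theorem volume_real_S1 : (volume : Measure S1).real univ = 2 * Real.pi := by
  rw [measureReal_def, AddCircle.measure_univ, ENNReal.toReal_ofReal Real.two_pi_pos.le]

theorem ae_real_of_ae_circle {p : S1 → Prop} (h : ∀ᵐ θ : S1, p θ) : ∀ᵐ x : ℝ, p (x : S1) := by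
  have h1 : ∀ n : ℤ, ∀ᵐ x : ℝ ∂volume.restrict
      (Ioc (n • (2 * Real.pi)) ((n + 1) • (2 * Real.pi))), p (x : S1) := fun n => by
    have := (AddCircle.measurePreserving_mk (2 * Real.pi)
      (n • (2 * Real.pi))).quasiMeasurePreserving.ae h
    rwa [add_smul, one_smul]
  have h2 := (ae_restrict_iUnion_iff (μ := (volume : Measure ℝ))
    (fun n : ℤ => Ioc (n • (2 * Real.pi)) ((n + 1) • (2 * Real.pi))) fun x => p (x : S1)).2 h1
  rwa [iUnion_Ioc_zsmul Real.two_pi_pos, Measure.restrict_univ] at h2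

variable {d : ℕ}

theorem intervalIntegrable_Linf (q : Linf d) (a b : ℝ) :
    IntervalIntegrable (fun x : ℝ => q (x : S1)) volume a b := by
  rw [intervalIntegrable_iff]
  refine Measure.integrableOn_of_bounded (M := ‖q‖) (by simp) ?_ ?_
  · exact ((Lp.stronglyMeasurable q).comp_measurable AddCircle.measurable_mk').aestronglyMeasurable
  · exact ae_restrict_of_ae (ae_real_of_ae_circle (Linfty.ae_norm_le_norm q))

/-- The projection `q ↦ q - (2π)⁻¹ ∫ q` of `L^∞` onto the functions with vanishing integral. -/
noncomputable def meanFree (d : ℕ) : Linf d →L[ℝ] Linf d :=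
  ContinuousLinearMap.id ℝ _ -
    (Lp.constL ∞ volume ℝ).comp ((2 * Real.pi)⁻¹ • Linfty.integralCLM volume (Euc d))

theorem meanFree_apply (q : Linf d) :
    meanFree d q = q - Lp.const ∞ volume ((2 * Real.pi)⁻¹ • ∫ θ, q θ) := by
  rw [← Linfty.integralCLM_apply]
  rfl

theorem integral_const_S1 (v : Euc d) : ∫ _ : S1, v = (2 * Real.pi) • v := by
  rw [integral_const, volume_real_S1]

theorem integral_meanFree (q : Linf d) : ∫ θ, meanFree d q θ = 0 := by
  rw [← Linfty.integralCLM_apply, meanFree_apply, map_sub, Linfty.integralCLM_apply,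
    Linfty.integralCLM_apply, integral_congr_ae (Lp.coeFn_const _ _ _)]
  simp only [Function.const_apply]
  rw [integral_const_S1, smul_smul, mul_inv_cancel₀ Real.two_pi_pos.ne', one_smul, sub_self]

theorem meanFree_of_integral_eq_zero {q : Linf d} (hq : ∫ θ, q θ = 0) : meanFree d q = q := by
  rw [meanFree_apply, hq, smul_zero, map_zero, sub_zero]

/-- The primitive `θ ↦ ∫_0^θ (q - mean q)`, for `θ ∈ [0, 2π)`. -/
noncomputable def primFun (q : Linf d) (θ : S1) : Euc d :=
  ∫ y in (0 : ℝ)..rep θ, meanFree d q (y : S1)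

theorem periodic_primitive (q : Linf d) :
    Function.Periodic (fun x : ℝ => ∫ y in (0 : ℝ)..x, meanFree d q (y : S1)) (2 * Real.pi) := by
  intro x
  have hp : Function.Periodic (fun y : ℝ => meanFree d q (y : S1)) (2 * Real.pi) := fun y => by
    simp only [AddCircle.coe_add_period]
  have h := hp.intervalIntegral_add_eq x 0
  rw [AddCircle.intervalIntegral_preimage, zero_add] at h
  have h0 : ∫ y in x..x + 2 * Real.pi, meanFree d q (y : S1) = 0 :=
    (AddCircle.intervalIntegral_preimage (2 * Real.pi) x fun θ => meanFree d q θ).trans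
      (integral_meanFree q)
  simp only
  rw [← intervalIntegral.integral_add_adjacent_intervals (intervalIntegrable_Linf _ 0 x)
    (intervalIntegrable_Linf _ x _), h0, add_zero]

theorem primFun_coe (q : Linf d) (x : ℝ) :
    primFun q (x : S1) = ∫ y in (0 : ℝ)..x, meanFree d q (y : S1) := by
  have h : ∀ θ : S1, primFun q θ = (periodic_primitive q).lift θ := fun θ => by
    rw [← coe_rep θ, Function.Periodic.lift_coe, coe_rep]
    rfl
  rw [h, Function.Periodic.lift_coe]

theorem exists_coe_eq_abs_eq_norm (θ : S1) : ∃ z : ℝ, (z : S1) = θ ∧ |z| = ‖θ‖ := by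
  refine ⟨rep θ - round ((2 * Real.pi)⁻¹ * rep θ) * (2 * Real.pi), ?_, ?_⟩
  · rw [AddCircle.coe_sub, coe_rep, ← zsmul_eq_mul, AddCircle.coe_zsmul, AddCircle.coe_period,
      smul_zero, sub_zero]
  · rw [← AddCircle.norm_eq, coe_rep]

theorem lipschitzWith_primFun (q : Linf d) : LipschitzWith ‖meanFree d q‖₊ (primFun q) := by
  refine LipschitzWith.of_dist_le_mul fun θ η => ?_
  obtain ⟨z, hz, hzn⟩ := exists_coe_eq_abs_eq_norm (θ - η)
  have hθ : θ = ((rep η + z : ℝ) : S1) := by rw [AddCircle.coe_add, coe_rep, hz]; abel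
  have h1 : primFun q θ = ∫ y in (0 : ℝ)..(rep η + z), meanFree d q (y : S1) := by
    rw [hθ, primFun_coe]
  rw [dist_eq_norm θ, ← hzn, h1, primFun, dist_eq_norm, intervalIntegral.integral_interval_sub_left
    (intervalIntegrable_Linf _ _ _) (intervalIntegrable_Linf _ _ _)]
  refine (intervalIntegral.norm_integral_le_of_norm_le_const_ae (C := ‖meanFree d q‖) ?_).trans_eq ?_
  · exact (ae_real_of_ae_circle (Linfty.ae_norm_le_norm (meanFree d q))).mono fun x hx _ => hx
  · rw [add_sub_cancel_left, coe_nnnorm]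

theorem lipschitzWith_primFun_sub (q : Linf d) (v : Euc d) :
    LipschitzWith ‖meanFree d q‖₊ fun θ => primFun q θ - v :=
  LipschitzWith.of_dist_le_mul fun θ η => by
    rw [dist_sub_right]
    exact (lipschitzWith_primFun q).dist_le_mul θ η

theorem norm_primFun_le (q : Linf d) (θ : S1) :
    ‖primFun q θ‖ ≤ ‖meanFree d q‖ * (2 * Real.pi) := by
  refine (intervalIntegral.norm_integral_le_of_norm_le_const_ae (C := ‖meanFree d q‖) ?_).trans ?_
  · exact (ae_real_of_ae_circle (Linfty.ae_norm_le_norm (meanFree d q))).mono fun x hx _ => hx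
  · have h : rep θ ∈ Ico 0 (0 + 2 * Real.pi) := (AddCircle.equivIco (2 * Real.pi) 0 θ).2
    have : |rep θ - 0| ≤ 2 * Real.pi := by
      rw [sub_zero, abs_of_nonneg h.1, ← zero_add (2 * Real.pi)]
      exact h.2.le
    gcongr

theorem integrable_primFun (q : Linf d) : Integrable (primFun q) volume :=
  (lipschitzWith_primFun q).continuous.integrable_of_hasCompactSupport
    (HasCompactSupport.of_compactSpace _)

theorem primFun_add (q r : Linf d) (θ : S1) : primFun (q + r) θ = primFun q θ + primFun r θ := by
  rw [primFun, map_add, primFun, primFun, ← intervalIntegral.integral_add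
    (intervalIntegrable_Linf _ _ _) (intervalIntegrable_Linf _ _ _)]
  refine intervalIntegral.integral_congr_ae ?_
  exact (ae_real_of_ae_circle (Lp.coeFn_add (meanFree d q) (meanFree d r))).mono fun x hx _ => hx

theorem primFun_smul (c : ℝ) (q : Linf d) (θ : S1) : primFun (c • q) θ = c • primFun q θ := by
  rw [primFun, map_smul, primFun, ← intervalIntegral.integral_smul]
  refine intervalIntegral.integral_congr_ae ?_
  exact (ae_real_of_ae_circle (Lp.coeFn_smul c (meanFree d q))).mono fun x hx _ => hx

theorem integral_primFun_add (q r : Linf d) :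
    ∫ θ, primFun (q + r) θ = (∫ θ, primFun q θ) + ∫ θ, primFun r θ := by
  rw [← integral_add (integrable_primFun q) (integrable_primFun r)]
  exact integral_congr_ae (.of_forall fun θ => primFun_add q r θ)

theorem integral_primFun_smul (c : ℝ) (q : Linf d) :
    ∫ θ, primFun (c • q) θ = c • ∫ θ, primFun q θ := by
  rw [← integral_smul]
  exact integral_congr_ae (.of_forall fun θ => primFun_smul c q θ)

/-- A Lipschitz function as an element of `W^{1,∞}`. -/
def W1.mk (f : S1 → Euc d) (h : ∃ K : ℝ≥0, LipschitzWith K f) : W1 d := (⟨f, h⟩ : lipSubmodule d)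

theorem W1.norm_le_of_lipschitz {c : W1 d} {K : ℝ≥0} (hc : LipschitzWith K c) {C : ℝ}
    (hC : ∀ θ, ‖c θ‖ ≤ C) : ‖c‖ ≤ C + K := by
  have hC0 : 0 ≤ C := (norm_nonneg _).trans (hC 0)
  rw [W1.norm_def]
  refine add_le_add ((ContinuousMap.norm_le _ hC0).2 hC) ?_
  rw [derivLp]
  change ‖(memLp_dTheta c).toLp‖ ≤ K
  rw [Lp.norm_toLp]
  refine ENNReal.toReal_le_of_le_ofReal K.2 ?_
  refine eLpNorm_le_of_ae_bound (C := K) (.of_forall (norm_dTheta_le hc)) |>.trans ?_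
  simp

/-- The mean-free primitive of a function in `L^∞(S¹, ℝ^d)`, after subtraction of its mean. -/
noncomputable def primitiveAux (q : Linf d) : W10 d :=
  ⟨W1.mk (fun θ => primFun q θ - (2 * Real.pi)⁻¹ • ∫ ζ, primFun q ζ)
    ⟨‖meanFree d q‖₊, lipschitzWith_primFun_sub q _⟩, by
    change ∫ θ : S1, (primFun q θ - (2 * Real.pi)⁻¹ • ∫ ζ, primFun q ζ) = 0
    rw [integral_sub (integrable_primFun q) (integrable_const _), integral_const_S1, smul_smul,
      mul_inv_cancel₀ Real.two_pi_pos.ne', one_smul, sub_self]⟩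

theorem primitiveAux_apply (q : Linf d) (θ : S1) :
    (primitiveAux q : W1 d) θ = primFun q θ - (2 * Real.pi)⁻¹ • ∫ ζ, primFun q ζ := rfl

/-- The mean-free primitive as a continuous linear map `L^∞ → W^{1,∞}_0`. -/
noncomputable def primitive (d : ℕ) : Linf d →L[ℝ] W10 d :=
  LinearMap.mkContinuous
    { toFun := primitiveAux
      map_add' := fun q r => by
        refine Subtype.ext (DFunLike.ext _ _ fun θ => ?_)
        change _ = (primitiveAux q : W1 d) θ + (primitiveAux r : W1 d) θ
        rw [primitiveAux_apply, primitiveAux_apply, primitiveAux_apply, primFun_add,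
          integral_primFun_add, smul_add]
        abel
      map_smul' := fun c q => by
        refine Subtype.ext (DFunLike.ext _ _ fun θ => ?_)
        change _ = c • (primitiveAux q : W1 d) θ
        rw [primitiveAux_apply, primitiveAux_apply, primFun_smul, integral_primFun_smul, smul_sub,
          smul_comm] }
    ((2 * (2 * Real.pi) + 1) * ‖meanFree d‖) (by
    intro q
    have hL : LipschitzWith ‖meanFree d q‖₊ (primitiveAux q : W1 d) :=
      lipschitzWith_primFun_sub q _
    have hC : ∀ θ, ‖(primitiveAux q : W1 d) θ‖ ≤
        ‖meanFree d q‖ * (2 * Real.pi) + ‖meanFree d q‖ * (2 * Real.pi) := by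
      intro θ
      have hI := norm_integral_le_of_norm_le_const (μ := (volume : Measure S1))
        (.of_forall (norm_primFun_le q))
      rw [volume_real_S1] at hI
      refine (norm_sub_le _ _).trans (add_le_add (norm_primFun_le q θ) ?_)
      rw [norm_smul, norm_inv, Real.norm_of_nonneg Real.two_pi_pos.le]
      refine (mul_le_mul_of_nonneg_left hI (by positivity)).trans_eq ?_
      field_simp
    refine (W1.norm_le_of_lipschitz hL hC).trans ?_
    rw [coe_nnnorm, mul_assoc]
    have := (meanFree d).le_opNorm q
    nlinarith [Real.pi_pos])

theorem primitive_apply (q : Linf d) (θ : S1) :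
    (primitive d q : W1 d) θ = primFun q θ - (2 * Real.pi)⁻¹ • ∫ ζ, primFun q ζ := rfl

/-! ### The derivative and completeness of `W^{1,∞}_0` -/

/-- The derivative `c ↦ c_θ` as a continuous linear map `W^{1,∞}_0 → L^∞`. -/
noncomputable def derivCLM (d : ℕ) : W10 d →L[ℝ] Linf d :=
  ((derivLp d).comp (W10 d).subtype).mkContinuous 1 fun c => by
    rw [one_mul]
    change ‖derivLp d c‖ ≤ ‖(c : W1 d)‖
    rw [W1.norm_def]
    linarith [norm_nonneg (toCont d (c : W1 d))]

theorem derivCLM_ae (c : W10 d) : derivCLM d c =ᵐ[volume] dTheta (c : W1 d) :=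
  MemLp.coeFn_toLp (memLp_dTheta (c : W1 d))

/-- The fundamental theorem of calculus for Lipschitz curves. -/
theorem integral_deriv_eq_sub_of_lipschitz {f : ℝ → Euc d} {K : ℝ≥0} (hf : LipschitzWith K f)
    (a b : ℝ) : ∫ x in a..b, deriv f x = f b - f a := by
  have hint : IntervalIntegrable (deriv f) volume a b := by
    rw [intervalIntegrable_iff]
    exact Measure.integrableOn_of_bounded (M := K) (by simp)
      (measurable_deriv f).aestronglyMeasurable
      (.of_forall fun x => norm_deriv_le_of_lipschitz hf)
  ext i
  let π : Euc d →L[ℝ] ℝ := EuclideanSpace.proj i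
  have hp : ∫ x in a..b, π (deriv f x) = π (∫ x in a..b, deriv f x) :=
    π.intervalIntegral_comp_comm hint
  have hi : LipschitzWith (‖π‖₊ * K) fun x => π (f x) := π.lipschitz.comp hf
  have hr := (hi.lipschitzOnWith (s := uIcc a b)).absolutelyContinuousOnInterval.integral_deriv_eq_sub
  change π (∫ x in a..b, deriv f x) = π (f b) - π (f a)
  rw [← hr, ← hp]
  refine intervalIntegral.integral_congr_ae ?_
  filter_upwards [hf.ae_differentiableAt] with x hx _
  exact ((π.hasFDerivAt.comp_hasDerivAt x hx.hasDerivAt).deriv).symm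

theorem integral_dTheta_coe (c : W1 d) (a b : ℝ) :
    ∫ x in a..b, dTheta c (x : S1) = c (b : S1) - c (a : S1) := by
  obtain ⟨K, hK⟩ := c.exists_lipschitz
  rw [← integral_deriv_eq_sub_of_lipschitz (lipschitz_lift hK) a b]
  exact intervalIntegral.integral_congr fun x _ => dTheta_coe c x

theorem integral_dTheta (c : W1 d) : ∫ θ, dTheta c θ = 0 := by
  rw [← AddCircle.intervalIntegral_preimage (2 * Real.pi) 0, integral_dTheta_coe,
    AddCircle.coe_add_period, sub_self]

/-- A function in `W^{1,∞}_0` is the mean-free primitive of its derivative. -/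
theorem primitive_derivCLM (c : W10 d) : primitive d (derivCLM d c) = c := by
  have h0 : ∫ θ, derivCLM d c θ = 0 := by
    rw [integral_congr_ae (derivCLM_ae c), integral_dTheta]
  have hA : ∀ θ, primFun (derivCLM d c) θ = (c : W1 d) θ - (c : W1 d) 0 := by
    intro θ
    rw [primFun, meanFree_of_integral_eq_zero h0]
    have := integral_dTheta_coe (c : W1 d) 0 (rep θ)
    rw [coe_rep] at this
    refine Eq.trans ?_ this
    exact intervalIntegral.integral_congr_ae
      ((ae_real_of_ae_circle (derivCLM_ae c)).mono fun x hx _ => hx)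
  have hc : ∫ θ, (c : W1 d) θ = 0 := c.2
  have hI : ∫ θ, primFun (derivCLM d c) θ = -((2 * Real.pi) • (c : W1 d) 0) := by
    simp only [hA]
    rw [integral_sub (c : W1 d).integrable (integrable_const _), integral_const_S1, hc, zero_sub]
  refine Subtype.ext (DFunLike.ext _ _ fun θ => ?_)
  rw [primitive_apply, hI, hA, smul_neg, smul_smul, inv_mul_cancel₀ Real.two_pi_pos.ne', one_smul]
  abel

/-- `W^{1,∞}_0` is a retract of the Banach space `L^∞`, hence complete. -/
instance completeSpace_W10 (d : ℕ) : CompleteSpace (W10 d) := by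
  refine Metric.complete_of_cauchySeq_tendsto fun u hu => ?_
  obtain ⟨q, hq⟩ := cauchySeq_tendsto_of_complete 
    ((derivCLM d).uniformContinuous.comp_cauchySeq hu)
  refine ⟨primitive d q, ?_⟩
  have := ((primitive d).continuous.tendsto q).comp hq
  refine this.congr fun n => ?_
  exact primitive_derivCLM (u n)

end LipschitzCurve

/-! ### The geodesic spray -/

namespace LipschitzCurve

open Linfty

variable {d : ℕ}

/-- The class of `|c_θ|` in `L^∞`. -/
noncomputable def speedLp (c : W10 d) : Lp ℝ ∞ (volume : Measure S1) := normLp (derivCLM d c)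

/-- The class of `D_s h` in `L^∞`. -/
noncomputable def DsLp (c h : W10 d) : Linf d := smulCLM volume (Euc d) (recip (speedLp c)) (derivCLM d h)

/-- The length `ℓ_c`, as a function of `c_θ ∈ L^∞`. -/
noncomputable def lengthLp (c : W10 d) : ℝ := integralCLM volume ℝ (speedLp c)

/-- The metric `G_c(h, k)`, in terms of pointwise operations on `L^∞`. -/
noncomputable def metricLp (c h k : W10 d) : ℝ :=
  (lengthLp c)⁻¹ * integralCLM volume ℝ
    (mulCLM volume (innerCLM volume (Euc d) (DsLp c h) (DsLp c k)) (speedLp c))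

/-- The class of `⟨D_s c, D_s u⟩ D_s u - ½ |D_s u|² D_s c` in `L^∞`. -/
noncomputable def forceLp (c u : W10 d) : Linf d :=
  smulCLM volume (Euc d) (innerCLM volume (Euc d) (DsLp c c) (DsLp c u)) (DsLp c u) -
    (1 / 2 : ℝ) • smulCLM volume (Euc d) (innerCLM volume (Euc d) (DsLp c u) (DsLp c u)) (DsLp c c)

/-- The class of `|c_θ| π₀ w`, the density of `π₀ w ds` with respect to `dθ`. -/
noncomputable def densityLp (c : W10 d) (w : Linf d) : Linf d :=
  smulCLM volume (Euc d) (speedLp c) (w - Lp.constL ∞ volume ℝ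
    ((lengthLp c)⁻¹ • integralCLM volume (Euc d) (smulCLM volume (Euc d) (speedLp c) w)))

/-- The right-hand side of the geodesic equation as a map into `W^{1,∞}_0`. -/
noncomputable def spray (c u : W10 d) : W10 d :=
  metricLp c c u • u - ((1 / 2 : ℝ) * metricLp c u u) • c +
    primitive d (densityLp c (forceLp c u))

/-! ### The spray represents the right-hand side of the geodesic equation -/

theorem mem_Imm0_iff (c : W10 d) : c ∈ Imm0 d ↔ derivCLM d c ∈ awayFromZero volume (Euc d) := by
  have h : ∀ m : ℝ, (∀ᵐ θ : S1, m ≤ ‖dTheta (c : W1 d) θ‖) ↔ ∀ᵐ θ : S1, m ≤ ‖derivCLM d c θ‖ :=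
    fun m => Filter.eventually_congr ((derivCLM_ae c).mono fun θ hθ => by rw [hθ])
  change (∃ m : ℝ, _) ↔ ∃ m : ℝ, _
  simp only [h]

theorem isOpen_Imm0 (d : ℕ) : IsOpen (Imm0 d) := by
  have : Imm0 d = derivCLM d ⁻¹' awayFromZero volume (Euc d) := ext mem_Imm0_iff
  rw [this]
  exact isOpen_awayFromZero.preimage (derivCLM d).continuous

theorem speedLp_ae (c : W10 d) : speedLp c =ᵐ[volume] fun θ => ‖dTheta (c : W1 d) θ‖ := by
  filter_upwards [normLp_ae (derivCLM d c), derivCLM_ae c] with θ h1 h2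
  rw [speedLp, h1, h2]

theorem lengthLp_eq (c : W10 d) : lengthLp c = length (c : W1 d) := by
  rw [lengthLp, integralCLM_apply, integral_congr_ae (speedLp_ae c), length]

theorem exists_le_speedLp {c : W10 d} (hc : c ∈ Imm0 d) : ∃ m > 0, ∀ᵐ θ, m ≤ speedLp c θ := by
  obtain ⟨m, hm, h⟩ := (mem_Imm0_iff c).1 hc
  exact ⟨m, hm, normLp_ge_ae h⟩

theorem lengthLp_pos {c : W10 d} (hc : c ∈ Imm0 d) : 0 < lengthLp c := by
  obtain ⟨m, hm, h⟩ := exists_le_speedLp hc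
  rw [lengthLp, integralCLM_apply]
  have hi : Integrable (speedLp c) volume := (Lp.memLp _).integrable le_top
  have := integral_mono_ae (integrable_const m) hi h
  rw [integral_const, volume_real_S1, smul_eq_mul] at this
  exact (mul_pos Real.two_pi_pos hm).trans_le this

theorem DsLp_ae {c : W10 d} (hc : c ∈ Imm0 d) (h : W10 d) :
    DsLp c h =ᵐ[volume] Ds (c : W1 d) (h : W1 d) := by
  obtain ⟨m, hm, hcm⟩ := exists_le_speedLp hc
  filter_upwards [smulCLM_ae (recip (speedLp c)) (derivCLM d h), recip_ae hm hcm, speedLp_ae c,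
    derivCLM_ae h] with θ h1 h2 h3 h4
  rw [DsLp, h1, h2, h3, h4, Ds]

theorem metricLp_eq {c : W10 d} (hc : c ∈ Imm0 d) (h k : W10 d) :
    metricLp c h k = G (c : W1 d) (h : W1 d) (k : W1 d) := by
  rw [metricLp, G, lengthLp_eq, integralCLM_apply]
  congr 1
  refine integral_congr_ae ?_
  filter_upwards [mulCLM_ae (innerCLM volume (Euc d) (DsLp c h) (DsLp c k)) (speedLp c),
    innerCLM_ae (DsLp c h) (DsLp c k), DsLp_ae hc h, DsLp_ae hc k, speedLp_ae c] with θ h1 h2 h3 h4 h5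
  rw [h1, h2, h3, h4, h5]

theorem forceLp_ae {c : W10 d} (hc : c ∈ Imm0 d) (u : W10 d) :
    forceLp c u =ᵐ[volume] fun η =>
      ⟪Ds (c : W1 d) (c : W1 d) η, Ds (c : W1 d) (u : W1 d) η⟫ • Ds (c : W1 d) (u : W1 d) η -
        ((1 / 2 : ℝ) * ‖Ds (c : W1 d) (u : W1 d) η‖ ^ 2) • Ds (c : W1 d) (c : W1 d) η := by
  rw [forceLp]
  filter_upwards [Lp.coeFn_sub
      (smulCLM volume (Euc d) (innerCLM volume (Euc d) (DsLp c c) (DsLp c u)) (DsLp c u))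
      ((1 / 2 : ℝ) • smulCLM volume (Euc d) (innerCLM volume (Euc d) (DsLp c u) (DsLp c u)) (DsLp c c)),
    Lp.coeFn_smul (1 / 2 : ℝ)
      (smulCLM volume (Euc d) (innerCLM volume (Euc d) (DsLp c u) (DsLp c u)) (DsLp c c)),
    smulCLM_ae (innerCLM volume (Euc d) (DsLp c c) (DsLp c u)) (DsLp c u),
    smulCLM_ae (innerCLM volume (Euc d) (DsLp c u) (DsLp c u)) (DsLp c c),
    innerCLM_ae (DsLp c c) (DsLp c u), innerCLM_ae (DsLp c u) (DsLp c u),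
    DsLp_ae hc c, DsLp_ae hc u] with θ h1 h2 h3 h4 h5 h6 h7 h8
  rw [h1, Pi.sub_apply, h2, Pi.smul_apply, h3, h4, h5, h6, h7, h8, smul_smul,
    real_inner_self_eq_norm_sq]

theorem densityLp_ae (c : W10 d) {w : Linf d} {f : S1 → Euc d} (hf : w =ᵐ[volume] f) :
    densityLp c w =ᵐ[volume] fun θ => ‖dTheta (c : W1 d) θ‖ • piZero (c : W1 d) f θ := by
  have hI : integralCLM volume (Euc d) (smulCLM volume (Euc d) (speedLp c) w) =
      ∫ η : S1, ‖dTheta (c : W1 d) η‖ • f η := by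
    rw [integralCLM_apply]
    refine integral_congr_ae ?_
    filter_upwards [smulCLM_ae (speedLp c) w, speedLp_ae c, hf] with θ h1 h2 h3
    rw [h1, h2, h3]
  rw [densityLp, hI, lengthLp_eq]
  set v := (length (c : W1 d))⁻¹ • ∫ η : S1, ‖dTheta (c : W1 d) η‖ • f η with hv
  filter_upwards [smulCLM_ae (speedLp c) (w - Lp.constL ∞ volume ℝ v), speedLp_ae c, hf,
    Lp.coeFn_sub w (Lp.constL ∞ volume ℝ v), Lp.coeFn_const ∞ (volume : Measure S1) v]
    with θ h1 h2 h3 h4 h5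
  rw [h1, h2, h4, Pi.sub_apply, h3, piZero, ← hv]
  congr 2

theorem integral_densityLp {c : W10 d} (hc : c ∈ Imm0 d) (w : Linf d) :
    ∫ θ, densityLp c w θ = 0 := by
  set v := (lengthLp c)⁻¹ • integralCLM volume (Euc d) (smulCLM volume (Euc d) (speedLp c) w) with hv
  have hconst : integralCLM volume (Euc d) (smulCLM volume (Euc d) (speedLp c)
      (Lp.constL ∞ volume ℝ v)) = lengthLp c • v := by
    rw [integralCLM_apply, lengthLp, integralCLM_apply, ← integral_smul_const]
    refine integral_congr_ae ?_
    filter_upwards [smulCLM_ae (speedLp c) (Lp.constL ∞ volume ℝ v),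
      Lp.coeFn_const ∞ (volume : Measure S1) v] with θ h1 h2
    rw [h1]
    congr 1
  rw [← integralCLM_apply, densityLp, map_sub, map_sub, hconst, hv, smul_smul,
    mul_inv_cancel₀ (lengthLp_pos hc).ne', one_smul, sub_self]

theorem primFun_densityLp {c : W10 d} (hc : c ∈ Imm0 d) {w : Linf d} {f : S1 → Euc d}
    (hf : w =ᵐ[volume] f) (θ : S1) :
    primFun (densityLp c w) θ = arcPrimitive (c : W1 d) (piZero (c : W1 d) f) θ := by
  rw [primFun, meanFree_of_integral_eq_zero (integral_densityLp hc w), arcPrimitive]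
  exact intervalIntegral.integral_congr_ae
    ((ae_real_of_ae_circle (densityLp_ae c hf)).mono fun x hx _ => hx)

theorem spray_apply {c : W10 d} (hc : c ∈ Imm0 d) (u : W10 d) (θ : S1) :
    (spray c u : W1 d) θ = geodesicRHS (c : W1 d) (u : W1 d) θ := by
  have hp : (primitive d (densityLp c (forceLp c u)) : W1 d) θ = DsInv (c : W1 d)
      (piZero (c : W1 d) fun η =>
        ⟪Ds (c : W1 d) (c : W1 d) η, Ds (c : W1 d) (u : W1 d) η⟫ • Ds (c : W1 d) (u : W1 d) η -
          ((1 / 2 : ℝ) * ‖Ds (c : W1 d) (u : W1 d) η‖ ^ 2) • Ds (c : W1 d) (c : W1 d) η) θ := by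
    rw [primitive_apply, DsInv]
    simp only [primFun_densityLp hc (forceLp_ae hc u)]
  rw [geodesicRHS, ← hp, ← metricLp_eq hc, ← metricLp_eq hc, sub_eq_add_neg, ← neg_smul, spray,
    sub_eq_add_neg, ← neg_smul]
  rfl

/-! ### The spray is smooth and quadratic in the velocity -/

theorem contDiffAt_speedLp {c : W10 d} (hc : c ∈ Imm0 d) :
    ContDiffAt ℝ ∞ (speedLp (d := d)) c :=
  (contDiffAt_normLp ((mem_Imm0_iff c).1 hc)).comp c (derivCLM d).contDiff.contDiffAt

theorem contDiffAt_lengthLp {c : W10 d} (hc : c ∈ Imm0 d) :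
    ContDiffAt ℝ ∞ (lengthLp (d := d)) c :=
  (integralCLM volume ℝ).contDiff.contDiffAt.comp c (contDiffAt_speedLp hc)

section Smooth

variable {X : Type*} [NormedAddCommGroup X] [NormedSpace ℝ X] {x : X} {c h k : X → W10 d}

theorem contDiffAt_DsLp (hx : c x ∈ Imm0 d) (hc : ContDiffAt ℝ ∞ c x) (hh : ContDiffAt ℝ ∞ h x) :
    ContDiffAt ℝ ∞ (fun y => DsLp (c y) (h y)) x := by
  obtain ⟨m, hm, hcm⟩ := exists_le_speedLp hx
  have h1 : ContDiffAt ℝ ∞ (fun y => recip (speedLp (c y))) x :=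
    ContDiffAt.comp x (contDiffAt_recip hm hcm) ((contDiffAt_speedLp hx).comp x hc)
  exact ((smulCLM volume (Euc d)).contDiff.contDiffAt.comp x h1).clm_apply
    ((derivCLM d).contDiff.contDiffAt.comp x hh)

theorem contDiffAt_innerCLM {f g : X → Linf d} (hf : ContDiffAt ℝ ∞ f x) (hg : ContDiffAt ℝ ∞ g x) :
    ContDiffAt ℝ ∞ (fun y => innerCLM volume (Euc d) (f y) (g y)) x :=
  ((innerCLM volume (Euc d)).contDiff.contDiffAt.comp x hf).clm_apply hg

theorem contDiffAt_smulCLM {f : X → Lp ℝ ∞ (volume : Measure S1)} {g : X → Linf d}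
    (hf : ContDiffAt ℝ ∞ f x) (hg : ContDiffAt ℝ ∞ g x) :
    ContDiffAt ℝ ∞ (fun y => smulCLM volume (Euc d) (f y) (g y)) x :=
  ((smulCLM volume (Euc d)).contDiff.contDiffAt.comp x hf).clm_apply hg

theorem contDiffAt_metricLp (hx : c x ∈ Imm0 d) (hc : ContDiffAt ℝ ∞ c x) (hh : ContDiffAt ℝ ∞ h x)
    (hk : ContDiffAt ℝ ∞ k x) : ContDiffAt ℝ ∞ (fun y => metricLp (c y) (h y) (k y)) x := by
  have h1 := contDiffAt_innerCLM (contDiffAt_DsLp hx hc hh) (contDiffAt_DsLp hx hc hk)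
  have h2 := ((mulCLM (volume : Measure S1)).contDiff.contDiffAt.comp x h1).clm_apply
    ((contDiffAt_speedLp hx).comp x hc)
  exact (((contDiffAt_lengthLp hx).comp x hc).inv (lengthLp_pos hx).ne').mul
    ((integralCLM (volume : Measure S1) ℝ).contDiff.contDiffAt.comp x h2)

theorem contDiffAt_forceLp (hx : c x ∈ Imm0 d) (hc : ContDiffAt ℝ ∞ c x)
    (hh : ContDiffAt ℝ ∞ h x) : ContDiffAt ℝ ∞ (fun y => forceLp (c y) (h y)) x := by
  have h1 := contDiffAt_DsLp hx hc hc
  have h2 := contDiffAt_DsLp hx hc hh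
  exact (contDiffAt_smulCLM (contDiffAt_innerCLM h1 h2) h2).sub
    ((contDiffAt_smulCLM (contDiffAt_innerCLM h2 h2) h1).const_smul _)

theorem contDiffAt_densityLp {w : X → Linf d} (hx : c x ∈ Imm0 d) (hc : ContDiffAt ℝ ∞ c x)
    (hw : ContDiffAt ℝ ∞ w x) : ContDiffAt ℝ ∞ (fun y => densityLp (c y) (w y)) x := by
  have hs := (contDiffAt_speedLp hx).comp x hc
  have h1 : ContDiffAt ℝ ∞ (fun y => integralCLM volume (Euc d)
      (smulCLM volume (Euc d) (speedLp (c y)) (w y))) x :=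
    (integralCLM volume (Euc d)).contDiff.contDiffAt.comp x (contDiffAt_smulCLM hs hw)
  have h2 := (((contDiffAt_lengthLp hx).comp x hc).inv (lengthLp_pos hx).ne').smul h1
  exact contDiffAt_smulCLM hs (hw.sub
    ((Lp.constL ∞ (volume : Measure S1) ℝ : Euc d →L[ℝ] Linf d).contDiff.contDiffAt.comp x h2))

end Smooth

theorem contDiffAt_spray {p : W10 d × W10 d} (hp : p.1 ∈ Imm0 d) :
    ContDiffAt ℝ ∞ (fun q : W10 d × W10 d => spray q.1 q.2) p := by
  have h1 : ContDiffAt ℝ ∞ (fun q : W10 d × W10 d => q.1) p := contDiffAt_fst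
  have h2 : ContDiffAt ℝ ∞ (fun q : W10 d × W10 d => q.2) p := contDiffAt_snd
  refine (((contDiffAt_metricLp hp h1 h1 h2).smul h2).sub
    ((contDiffAt_const.mul (contDiffAt_metricLp hp h1 h2 h2)).smul h1)).add ?_
  exact (primitive d).contDiff.contDiffAt.comp p
    (contDiffAt_densityLp hp h1 (contDiffAt_forceLp hp h1 h2))

theorem DsLp_smul (c h : W10 d) (r : ℝ) : DsLp c (r • h) = r • DsLp c h := by
  rw [DsLp, map_smul, map_smul, DsLp]

theorem forceLp_smul (c u : W10 d) (r : ℝ) : forceLp c (r • u) = r ^ 2 • forceLp c u := by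
  simp only [forceLp, DsLp_smul, map_smul, smul_apply, smul_smul, smul_sub]
  ring_nf

theorem densityLp_smul (c : W10 d) (w : Linf d) (r : ℝ) :
    densityLp c (r • w) = r • densityLp c w := by
  simp only [densityLp, map_smul, map_sub, smul_sub]
  rw [smul_comm _ r, smul_comm r]

theorem spray_smul (c u : W10 d) (r : ℝ) : spray c (r • u) = r ^ 2 • spray c u := by
  have h1 : metricLp c c (r • u) = r * metricLp c c u := by
    simp only [metricLp, DsLp_smul, map_smul, smul_apply, smul_eq_mul]
    ring
  have h2 : metricLp c (r • u) (r • u) = r ^ 2 * metricLp c u u := by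
    simp only [metricLp, DsLp_smul, map_smul, smul_apply, smul_eq_mul]
    ring
  simp only [spray, h1, h2, forceLp_smul, densityLp_smul, map_smul, smul_add, smul_sub, smul_smul]
  ring_nf

theorem spray_zero (c : W10 d) : spray c 0 = 0 := by
  simpa using spray_smul c 0 0

end LipschitzCurve

/-! ### The inverse function theorem on open sets -/

theorem isLocalDiffeomorphOn_of_fderiv_mem_range {X Y : Type*} [NormedAddCommGroup X]
    [NormedSpace ℝ X] [CompleteSpace X] [NormedAddCommGroup Y] [NormedSpace ℝ Y] {f : X → Y}
    {V : Set X} (hV : IsOpen V) (hf : ContDiffOn ℝ ∞ f V)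
    (hf' : ∀ p ∈ V, fderiv ℝ f p ∈ range ((↑) : (X ≃L[ℝ] Y) → X →L[ℝ] Y)) :
    IsLocalDiffeomorphOn 𝓘(ℝ, X) 𝓘(ℝ, Y) ∞ f V := by
  have hfd : ∀ p ∈ V, HasFDerivAt f (fderiv ℝ f p) p := fun p hp =>
    ((hf.contDiffAt (hV.mem_nhds hp)).differentiableAt (by simp)).hasFDerivAt
  rintro ⟨p, hp⟩
  obtain ⟨e, he⟩ := hf' p hp
  have hfe : HasFDerivAt f (e : X →L[ℝ] Y) p := he ▸ hfd p hp
  have hfp := hf.contDiffAt (hV.mem_nhds hp)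
  let Φ := (hfp.toOpenPartialHomeomorph f hfe (by simp)).restrOpen V hV
  have hsub : Φ.source ⊆ V := fun x hx => hx.2
  refine ⟨{ Φ.toPartialEquiv with
    open_source := Φ.open_source
    open_target := Φ.open_target
    contMDiffOn_toFun := contMDiffOn_iff_contDiffOn.2 (hf.mono hsub)
    contMDiffOn_invFun := contMDiffOn_iff_contDiffOn.2 fun y hy => ?_ },
    ⟨hfp.mem_toOpenPartialHomeomorph_source hfe (by simp), hp⟩, fun x _ => rfl⟩
  have hxV : Φ.symm y ∈ V := hsub (Φ.map_target hy)
  obtain ⟨e', he'⟩ := hf' _ hxV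
  exact (Φ.contDiffAt_symm hy (f₀' := e') (he' ▸ hfd _ hxV)
    (hf.contDiffAt (hV.mem_nhds hxV))).contDiffWithinAt

theorem isOpen_image_of_fderiv_mem_range {X Y : Type*} [NormedAddCommGroup X]
    [NormedSpace ℝ X] [CompleteSpace X] [NormedAddCommGroup Y] [NormedSpace ℝ Y] {f : X → Y}
    {V : Set X} (hV : IsOpen V) (hf : ContDiffOn ℝ ∞ f V)
    (hf' : ∀ p ∈ V, fderiv ℝ f p ∈ range ((↑) : (X ≃L[ℝ] Y) → X →L[ℝ] Y)) : IsOpen (f '' V) := by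
  rw [isOpen_iff_mem_nhds]
  rintro _ ⟨p, hp, rfl⟩
  obtain ⟨e, he⟩ := hf' p hp
  have h : HasStrictFDerivAt f (e : X →L[ℝ] Y) p := by
    rw [he]
    exact (hf.contDiffAt (hV.mem_nhds hp)).hasStrictFDerivAt (by simp)
  rw [← h.map_nhds_eq_of_equiv]
  exact Filter.image_mem_map (hV.mem_nhds hp)

/-! ### Geodesics and the geodesic flow -/

namespace LipschitzCurve

open SmoothODE

variable {d : ℕ}

/-- The first order vector field `(c, u) ↦ (u, spray c u)`. -/
noncomputable def sprayField (p : W10 d × W10 d) : W10 d × W10 d := (p.2, spray p.1 p.2)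

/-- The domain `𝓘^{1,∞}_0 × W^{1,∞}_0` of the vector field `sprayField`. -/
def phaseSpace (d : ℕ) : Set (W10 d × W10 d) := Prod.fst ⁻¹' Imm0 d

theorem isOpen_phaseSpace (d : ℕ) : IsOpen (phaseSpace d) := (isOpen_Imm0 d).preimage continuous_fst

theorem contDiffOn_sprayField (d : ℕ) : ContDiffOn ℝ ∞ (sprayField (d := d)) (phaseSpace d) :=
  fun _ hp => (contDiffAt_snd.prodMk (contDiffAt_spray hp)).contDiffWithinAt

theorem isGeodesicOn_iff {J : Set ℝ} {y : ℝ → W10 d × W10 d} :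
    IsGeodesicOn J (fun t => (y t).1) (fun t => (y t).2) ↔
      IsSolutionOn sprayField (phaseSpace d) J y := by
  refine ⟨fun h t ht => ⟨h.mem t ht, ?_⟩, fun h => ⟨fun t ht => (h t ht).1, fun t ht => ?_,
    fun t ht => ⟨spray (y t).1 (y t).2, ?_, fun θ => spray_apply (h t ht).1 _ θ⟩⟩⟩
  · obtain ⟨a, ha, hθ⟩ := h.acceleration t ht
    have : a = spray (y t).1 (y t).2 := Subtype.ext (DFunLike.ext _ _ fun θ =>
      (hθ θ).trans (spray_apply (h.mem t ht) _ θ).symm)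
    exact (h.velocity t ht).prodMk (this ▸ ha)
  · exact (ContinuousLinearMap.fst ℝ (W10 d) (W10 d)).hasFDerivAt.comp_hasDerivWithinAt t (h t ht).2
  · exact (ContinuousLinearMap.snd ℝ (W10 d) (W10 d)).hasFDerivAt.comp_hasDerivWithinAt t (h t ht).2

theorem IsGeodesicOn.isSolutionOn {J : Set ℝ} {c u : ℝ → W10 d} (h : IsGeodesicOn J c u) :
    IsSolutionOn sprayField (phaseSpace d) J fun t => (c t, u t) :=
  isGeodesicOn_iff.1 h

theorem exists_isGeodesicOn {c₀ : W10 d} (hc₀ : c₀ ∈ Imm0 d) (h₀ : W10 d) :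
    ∃ ε > 0, ∃ c u : ℝ → W10 d, IsGeodesicOn (Ioo (-ε) ε) c u ∧ c 0 = c₀ ∧ u 0 = h₀ := by
  obtain ⟨ε, hε, y, hy, hy0⟩ := exists_isSolutionOn (isOpen_phaseSpace d)
    ((contDiffOn_sprayField d).of_le (by simp)) (x := (c₀, h₀)) hc₀
  exact ⟨ε, hε, _, _, isGeodesicOn_iff.2 hy, by rw [hy0], by rw [hy0]⟩

theorem IsGeodesicOn.eqOn {J : Set ℝ} {c u c' u' : ℝ → W10 d} (hJ : J.OrdConnected) (h0 : 0 ∈ J)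
    (h : IsGeodesicOn J c u) (h' : IsGeodesicOn J c' u') (hc : c 0 = c' 0) (hu : u 0 = u' 0) :
    EqOn c c' J ∧ EqOn u u' J := by
  have := h.isSolutionOn.eqOn (isOpen_phaseSpace d) ((contDiffOn_sprayField d).of_le (by simp)) hJ h0
    h'.isSolutionOn (Prod.ext hc hu)
  exact ⟨fun t ht => congrArg Prod.fst (this ht), fun t ht => congrArg Prod.snd (this ht)⟩

theorem IsGeodesicOn.mono {J J' : Set ℝ} {c u : ℝ → W10 d} (h : IsGeodesicOn J c u) (hJ : J' ⊆ J) :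
    IsGeodesicOn J' c u :=
  isGeodesicOn_iff.2 (h.isSolutionOn.mono hJ)

theorem GeodesicReaches.unique {t : ℝ} {c₀ h₀ x x' : W10 d} (h : GeodesicReaches t c₀ h₀ x)
    (h' : GeodesicReaches t c₀ h₀ x') : x = x' := by
  obtain ⟨J, c, u, -, hJ, h0, ht, hg, hc, hu, rfl⟩ := h
  obtain ⟨J', c', u', -, hJ', h0', ht', hg', hc', hu', rfl⟩ := h'
  exact ((hg.mono inter_subset_left).eqOn (hJ.inter hJ') ⟨h0, h0'⟩ (hg'.mono inter_subset_right)
    (hc.trans hc'.symm) (hu.trans hu'.symm)).1 ⟨ht, ht'⟩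

theorem GeodesicReaches.geodesicFlow_eq {q : ℝ × W10 d × W10 d} {x : W10 d}
    (h : GeodesicReaches q.1 q.2.1 q.2.2 x) : geodesicFlow q = x := by
  have hex : ∃ x, GeodesicReaches q.1 q.2.1 q.2.2 x := ⟨x, h⟩
  rw [geodesicFlow, dif_pos hex]
  exact hex.choose_spec.unique h

theorem exists_contDiffAt_geodesicReaches {q : ℝ × W10 d × W10 d} (hq : q ∈ flowDomain d) :
    ∃ σ : ℝ × W10 d × W10 d → W10 d, ContDiffAt ℝ ∞ σ q ∧
      ∀ᶠ r in 𝓝 q, GeodesicReaches r.1 r.2.1 r.2.2 (σ r) := by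
  obtain ⟨t, c₀, h₀⟩ := q
  obtain ⟨x, J, c, u, hJ, hJc, h0, ht, hg, rfl, rfl, -⟩ := hq
  obtain ⟨σ, hσ, hev⟩ := exists_contDiffAt_flow (isOpen_phaseSpace d) (contDiffOn_sprayField d) hJ hJc
    h0 ht hg.isSolutionOn
  refine ⟨fun r => (σ r).1, hσ.fst, hev.mono ?_⟩
  rintro r ⟨J', z, hJ', hJc', h0', hr, hz, hz0, hzr⟩
  exact ⟨J', _, _, hJ', hJc', h0', hr, isGeodesicOn_iff.2 hz, by rw [hz0], by rw [hz0], by rw [hzr]⟩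

theorem isOpen_flowDomain (d : ℕ) : IsOpen (flowDomain d) := by
  rw [isOpen_iff_mem_nhds]
  intro q hq
  obtain ⟨σ, -, hev⟩ := exists_contDiffAt_geodesicReaches hq
  exact hev.mono fun r hr => ⟨_, hr⟩

theorem contDiffAt_geodesicFlow {q : ℝ × W10 d × W10 d} (hq : q ∈ flowDomain d) :
    ContDiffAt ℝ ∞ (geodesicFlow (d := d)) q := by
  obtain ⟨σ, hσ, hev⟩ := exists_contDiffAt_geodesicReaches hq
  exact hσ.congr_of_eventuallyEq (hev.mono fun r hr => hr.geodesicFlow_eq)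

/-! ### The exponential mapping -/

theorem isOpen_expDomain (d : ℕ) : IsOpen (expDomain d) :=
  (isOpen_flowDomain d).preimage (by fun_prop : Continuous fun p : W10 d × W10 d => ((1 : ℝ), p))

theorem contDiffAt_expMap {p : W10 d × W10 d} (hp : p ∈ expDomain d) :
    ContDiffAt ℝ ∞ (expMap (d := d)) p :=
  ContDiffAt.comp p (contDiffAt_geodesicFlow (q := (1, p)) hp) (by fun_prop)

theorem geodesicReaches_const {c : W10 d} (hc : c ∈ Imm0 d) (t : ℝ) : GeodesicReaches t c 0 c := by
  refine ⟨univ, fun _ => c, fun _ => 0, isOpen_univ, ordConnected_univ, trivial, trivial, ?_, rfl, rfl,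
    rfl⟩
  refine isGeodesicOn_iff (y := fun _ => (c, 0)).2 fun t _ => ⟨hc, ?_⟩
  rw [sprayField, spray_zero]
  exact hasDerivWithinAt_const _ _ _

/-- Homogeneity: the geodesic with initial velocity `s h` reaches at time `1` the point which the
geodesic with initial velocity `h` reaches at time `s`. -/
theorem IsGeodesicOn.geodesicReaches_one {J : Set ℝ} {c u : ℝ → W10 d} (hJ : IsOpen J)
    (hJc : J.OrdConnected) (h0 : 0 ∈ J) (h : IsGeodesicOn J c u) {s : ℝ} (hs : s ∈ J) :
    GeodesicReaches 1 (c 0) (s • u 0) (c s) := by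
  refine ⟨(fun τ => s * τ) ⁻¹' J, fun τ => c (s * τ), fun τ => s • u (s * τ),
    hJ.preimage (by fun_prop), hJc.preimage_const_mul s, by simpa using h0, by simpa using hs, ?_,
    by simp, by simp, by simp⟩
  refine isGeodesicOn_iff (y := fun τ => (c (s * τ), s • u (s * τ))).2 fun τ hτ => ⟨h.mem _ hτ, ?_⟩
  have hm : HasDerivWithinAt (fun τ => s * τ) s ((fun τ => s * τ) ⁻¹' J) τ := by
    simpa using ((hasDerivAt_id τ).const_mul s).hasDerivWithinAt
  have hd := (h.isSolutionOn _ hτ).2.scomp τ hm (mapsTo_preimage _ _)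
  have h1 := (ContinuousLinearMap.fst ℝ (W10 d) (W10 d)).hasFDerivAt.comp_hasDerivWithinAt τ hd
  have h2 := (ContinuousLinearMap.snd ℝ (W10 d) (W10 d)).hasFDerivAt.comp_hasDerivWithinAt τ hd
  have h3 := h1.prodMk (h2.const_smul s)
  refine h3.congr_deriv ?_
  simp only [sprayField, spray_smul, ContinuousLinearMap.coe_fst', ContinuousLinearMap.coe_snd',
    Prod.smul_mk, smul_smul, pow_two]

theorem mk_zero_mem_expDomain {c : W10 d} (hc : c ∈ Imm0 d) :
    ((c, 0) : W10 d × W10 d) ∈ expDomain d :=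
  ⟨c, geodesicReaches_const hc 1⟩

theorem expMap_zero {c : W10 d} (hc : c ∈ Imm0 d) : expMap (c, 0) = c :=
  GeodesicReaches.geodesicFlow_eq (q := (1, c, 0)) (geodesicReaches_const hc 1)

theorem mem_Imm0_of_mem_expDomain {p : W10 d × W10 d} (hp : p ∈ expDomain d) :
    p.1 ∈ Imm0 d ∧ expMap p ∈ Imm0 d := by
  obtain ⟨c₀, h₀⟩ := p
  obtain ⟨x, hx⟩ := hp
  rw [show expMap (c₀, h₀) = x from hx.geodesicFlow_eq]
  obtain ⟨J, c, u, -, -, h0, h1, hg, rfl, -, rfl⟩ := hx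
  exact ⟨hg.mem 0 h0, hg.mem 1 h1⟩

/-- On the zero section the derivative of `exp` is `(k, h) ↦ k + h`: in the first variable `exp` is
the identity, and by homogeneity `s ↦ exp_c (s h)` is the geodesic with initial velocity `h`. -/
theorem fderiv_expMap_zero {c : W10 d} (hc : c ∈ Imm0 d) (k h : W10 d) :
    fderiv ℝ (expMap (d := d)) (c, 0) (k, h) = k + h := by
  have hE : HasFDerivAt (expMap (d := d)) (fderiv ℝ (expMap (d := d)) (c, 0)) (c, 0) :=
    ((contDiffAt_expMap (mk_zero_mem_expDomain hc)).differentiableAt (by simp)).hasFDerivAt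
  have h1 : fderiv ℝ (expMap (d := d)) (c, 0) (k, 0) = k := by
    have ha : HasFDerivAt (fun c' : W10 d => expMap (c', 0))
        (fderiv ℝ expMap (c, 0) ∘L .inl ℝ (W10 d) (W10 d)) c :=
      HasFDerivAt.comp (g := expMap) c hE (hasFDerivAt_prodMk_left c (0 : W10 d))
    have hb : HasFDerivAt (fun c' : W10 d => expMap (c', 0)) (ContinuousLinearMap.id ℝ (W10 d)) c :=
      (hasFDerivAt_id c).congr_of_eventuallyEq
        (((isOpen_Imm0 d).eventually_mem hc).mono fun c' hc' => expMap_zero hc')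
    exact congrArg (fun L : W10 d →L[ℝ] W10 d => L k) (ha.unique hb)
  have h2 : fderiv ℝ (expMap (d := d)) (c, 0) (0, h) = h := by
    obtain ⟨ε, hε, γ, u, hg, rfl, rfl⟩ := exists_isGeodesicOn hc h
    have hmem : (0 : ℝ) ∈ Ioo (-ε) ε := ⟨by linarith, hε⟩
    have hline : HasDerivAt (fun s : ℝ => (γ 0, s • u 0)) ((0 : W10 d), u 0) 0 := by
      have := (hasDerivAt_id (0 : ℝ)).smul_const (u 0)
      rw [one_smul] at this
      exact (hasDerivAt_const 0 (γ 0)).prodMk this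
    have hE' : HasFDerivAt (expMap (d := d)) (fderiv ℝ (expMap (d := d)) (γ 0, 0))
        (γ 0, (0 : ℝ) • u 0) := by rwa [zero_smul]
    have ha := hE'.comp_hasDerivAt 0 hline
    have hb : HasDerivAt (fun s : ℝ => expMap (γ 0, s • u 0)) (u 0) 0 := by
      refine ((hg.velocity 0 hmem).hasDerivAt (isOpen_Ioo.mem_nhds hmem)).congr_of_eventuallyEq ?_
      filter_upwards [isOpen_Ioo.mem_nhds hmem] with s hs
      exact GeodesicReaches.geodesicFlow_eq (q := (1, γ 0, s • u 0))
        (hg.geodesicReaches_one isOpen_Ioo ordConnected_Ioo hmem hs)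
    exact ha.unique hb
  rw [show ((k, h) : W10 d × W10 d) = (k, 0) + (0, h) by simp, map_add, h1, h2]

/-- The map `(c, h) ↦ (c, exp_c h)`. -/
noncomputable def expPair (p : W10 d × W10 d) : W10 d × W10 d := (p.1, expMap p)

theorem contDiffOn_expPair (d : ℕ) : ContDiffOn ℝ ∞ (expPair (d := d)) (expDomain d) :=
  fun _ hp => (contDiffAt_fst.prodMk (contDiffAt_expMap hp)).contDiffWithinAt

/-- The points of the domain of `exp` at which the derivative of `expPair` is invertible. -/
def regularDomain (d : ℕ) : Set (W10 d × W10 d) :=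
  expDomain d ∩ fderiv ℝ expPair ⁻¹'
    range ((↑) : ((W10 d × W10 d) ≃L[ℝ] (W10 d × W10 d)) → (W10 d × W10 d) →L[ℝ] (W10 d × W10 d))

theorem isOpen_regularDomain (d : ℕ) : IsOpen (regularDomain d) :=
  ((contDiffOn_expPair d).continuousOn_fderiv_of_isOpen (isOpen_expDomain d)
    (by simp)).isOpen_inter_preimage (isOpen_expDomain d) ContinuousLinearEquiv.isOpen

theorem mk_zero_mem_regularDomain {c : W10 d} (hc : c ∈ Imm0 d) :
    ((c, 0) : W10 d × W10 d) ∈ regularDomain d := by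
  refine ⟨mk_zero_mem_expDomain hc, ?_⟩
  let f := ContinuousLinearMap.fst ℝ (W10 d) (W10 d)
  let g := ContinuousLinearMap.snd ℝ (W10 d) (W10 d)
  refine ⟨ContinuousLinearEquiv.equivOfInverse (f.prod (f + g)) (f.prod (g - f))
    (fun p => by simp [f, g]) (fun p => by simp [f, g]), ?_⟩
  have hE := ((contDiffAt_expMap (mk_zero_mem_expDomain hc)).differentiableAt
    (by simp)).hasFDerivAt
  have hP : HasFDerivAt (expPair (d := d)) (f.prod (fderiv ℝ expMap (c, 0))) (c, 0) :=
    hasFDerivAt_fst.prodMk hE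
  rw [hP.fderiv]
  refine ContinuousLinearMap.ext fun p => ?_
  exact Prod.ext rfl (fderiv_expMap_zero hc p.1 p.2).symm

end LipschitzCurve

theorem mainTheorem3 (d : ℕ) (hd : 2 ≤ d) :
    -- Local existence for the initial value problem.
    (∀ c₀ ∈ Imm0 d, ∀ h₀ : W10 d, ∃ ε > 0, ∃ c u : ℝ → W10 d,
      IsGeodesicOn (Ioo (-ε) ε) c u ∧ c 0 = c₀ ∧ u 0 = h₀) ∧
    -- Uniqueness on every interval (open or not) that contains the initial time.
    (∀ (J : Set ℝ) (c u c' u' : ℝ → W10 d), J.OrdConnected → 0 ∈ J →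
      IsGeodesicOn J c u → IsGeodesicOn J c' u' → c 0 = c' 0 → u 0 = u' 0 →
      EqOn c c' J ∧ EqOn u u' J) ∧
    -- Smooth dependence on time and on the initial data.
    IsOpen (flowDomain d) ∧ ContDiffOn ℝ ∞ geodesicFlow (flowDomain d) ∧
    -- The exponential mapping exists and is smooth on a neighbourhood of the zero section,
    -- and on a possibly smaller one `(c, h) ↦ (c, exp_c h)` is a local diffeomorphism onto a
    -- neighbourhood of the diagonal.
    ∃ U : Set (W10 d × W10 d), IsOpen U ∧ U ⊆ expDomain d ∧ Imm0 d ×ˢ {0} ⊆ U ∧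
      ContDiffOn ℝ ∞ expMap U ∧
      ∃ V ⊆ U, IsOpen V ∧ Imm0 d ×ˢ {0} ⊆ V ∧
        IsLocalDiffeomorphOn 𝓘(ℝ, W10 d × W10 d) 𝓘(ℝ, W10 d × W10 d) ∞
          (fun p => (p.1, expMap p)) V ∧
        IsOpen ((fun p => (p.1, expMap p)) '' V) ∧
        (fun p => (p.1, expMap p)) '' V ⊆ Imm0 d ×ˢ Imm0 d ∧
        ∀ c ∈ Imm0 d, (c, c) ∈ (fun p => (p.1, expMap p)) '' V := by
  have hsmooth := (contDiffOn_expPair d).mono (inter_subset_left : regularDomain d ⊆ _)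
  refine ⟨fun c₀ hc₀ h₀ => exists_isGeodesicOn hc₀ h₀,
    fun J c u c' u' hJ h0 h h' hc hu => h.eqOn hJ h0 h' hc hu, isOpen_flowDomain d,
    fun q hq => (contDiffAt_geodesicFlow hq).contDiffWithinAt,
    expDomain d, isOpen_expDomain d, Subset.rfl, ?_,
    fun p hp => (contDiffAt_expMap hp).contDiffWithinAt,
    regularDomain d, inter_subset_left, isOpen_regularDomain d, ?_,
    isLocalDiffeomorphOn_of_fderiv_mem_range (isOpen_regularDomain d) hsmooth fun p hp => hp.2,
    isOpen_image_of_fderiv_mem_range (isOpen_regularDomain d) hsmooth fun p hp => hp.2, ?_, ?_⟩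
  · rintro ⟨c, h⟩ ⟨hc, rfl⟩
    exact mk_zero_mem_expDomain hc
  · rintro ⟨c, h⟩ ⟨hc, rfl⟩
    exact mk_zero_mem_regularDomain hc
  · rintro _ ⟨p, hp, rfl⟩
    exact mem_Imm0_of_mem_expDomain hp.1
  · exact fun c hc => ⟨(c, 0), mk_zero_mem_regularDomain hc, by simp [expMap_zero hc]⟩
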